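/- **Setting.** Fix an activation $\sigma:\mathbb R\to\mathbb R$ that is real analytic, strictly increasing and $1$-Lipschitz, with $\lim_{x\to-\infty}\sigma(x)>-\infty$ and $\lim_{x\to+\infty}\sigma(x)\le+\infty$ existing, and variances $c_w,c_b>0$. A network architecture $f$ with $H$ hidden layers, input dimension $m_0=m_x\ge1$, output dimension $m_{H+1}=m_y\ge 1$ and hidden widths $m_1,\dots,m_H\ge1$ is $$x^{(0)}=x,\qquad x^{(l)}=\tfrac1{\sqrt{m_l}}\,\sigma\big(W^{(l)}x^{(l-1)}+b^{(l)}\big)\ (1\le l\le H),\qquad f(x,\theta)=W^{(H+1)}x^{(H)}+b^{(H+1)},$$ with $\sigma$ applied coordinatewise; $\theta$ is the vector of all entries of the matrices $\bar W^{(l)}=[W^{(l)},b^{(l)}]$, $1\le l\le H+1$. It has $\sum_{l=0}^{H}(m_lm_{l+1}+m_{l+1})$ parameters. The initial vector $\theta^0$ has independent entries, $N(0,c_w)$ for weights and $N(0,c_b)$ for biases. A dataset of size $n$ is $S=\{(x_i,y_i)\}_{i=1}^n$ with $x_i\in\mathbb R^{m_x}$, $\|x_i\|_2=1$ and $y_i\in[-1,1]^{m_y}$.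 For $\zeta>0$, $\mathcal L_S^\zeta$ is the set of functionals $L(g)=\frac1n\sum_{i=1}^n\ell(g(x_i),y_i)$ on functions $g:\mathbb R^{m_x}\to\mathbb R^{m_y}$ that have a global minimizer and for which every $q\mapsto\ell(q,y_i)$ is nonnegative, differentiable and convex with $\zeta$-Lipschitz gradient (Euclidean norm). Put $J(\theta)=L(f(\cdot,\theta))$. For a step-size vector $\eta$ (one real number per parameter) gradient descent is $\theta^{k+1}=\theta^k-\eta\odot\nabla J(\theta^k)$, with $\odot$ the entrywise product. Let $$c_r=\max_{1\le l\le H+1}\ \inf_{\bar W^*\in\mathcal W_l^*}\big\|\bar W^*-(\bar W^{(l)})^0\big\|_F^2,$$ where $\mathcal W_l^*$ is the set of matrices $\bar W$ that minimize $J$ when the block $\bar W^{(l)}$ of $\theta^0$ is replaced by $\bar W$ and all other blocks keep their initial values; layers with $\mathcal W_l^*=\emptyset$ contribute $0$ to the maximum. **Probable trainability.** For $C>0$, $\mathcal P_{n,H,\delta}(d)$ with implied constant $C$ is the following statement: for every $\zeta>0$ there are an architecture $f$ with $H$ hidden layers and at most $d$ parameters and a step-size vector $\eta$ such that for every dataset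 $S$ of size $n$ and every $L\in\mathcal L_S^\zeta$ there is $c_\theta\in\mathbb R$ such that for every $\epsilon>0$, with probability at least $1-\delta$ over $\theta^0$, there is $t\in\mathbb N$ with $$t\le C\,\frac{c_r\zeta}{\epsilon},\qquad J(\theta^t)\le L(f^*)+\epsilon,\qquad \|\theta^t\|_2^2\le c_\theta,$$ where $f^*$ is a global minimizer of $L$ over all functions $g:\mathbb R^{m_x}\to\mathbb R^{m_y}$. **Theorem.** There is a universal constant $\mathfrak c>0$ such that the following holds. For all $\sigma,c_w,c_b$ as above, all $H\ge2$ and all $0<\delta\le1$ there is $C>0$ (depending only on $\sigma,c_w,c_b,H,\delta$) such that for all integers $n,m_x,m_y\ge1$, the statement $\mathcal P_{n,H,\delta}(d)$ with implied constant $C$ is true for every integer $$d\ \ge\ \mathfrak c\left(\Big(n+m_xH^2+H^5\log\frac{Hn^2}{\delta}\Big)\log\frac{Hn^2}{\delta}+n\,m_y\right).$$ -/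

import Mathlib

open Filter Topology MeasureTheory ProbabilityTheory
open scoped NNReal ENNReal BigOperators

noncomputable section

namespace DeepNet

/-- Common activation units: real analytic, increasing, `1`-Lipschitz, with a finite limit at `-∞`
and a finite or `+∞` limit at `+∞`. -/
structure IsActivation (σ : ℝ → ℝ) : Prop where
  analytic : AnalyticOnNhd ℝ σ Set.univ
  increasing : StrictMono σ
  lipschitz : LipschitzWith 1 σ
  limit_bot : ∃ a : ℝ, Tendsto σ atBot (𝓝 a)
  limit_top : (∃ b : ℝ, Tendsto σ atTop (𝓝 b)) ∨ Tendsto σ atTop atTop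

/-- Common loss criteria `q ↦ ℓ(q, y)`: nonnegative, differentiable and convex, with `ζ`-Lipschitz
gradient for the Euclidean norm. -/
structure IsLossCriterion {my : ℕ} (ζ : ℝ) (φ : EuclideanSpace ℝ (Fin my) → ℝ) : Prop where
  nonneg : ∀ q, 0 ≤ φ q
  differentiable : Differentiable ℝ φ
  convex : ConvexOn ℝ Set.univ φ
  lipschitz : ∀ q q', ‖gradient φ q - gradient φ q'‖ ≤ ζ * ‖q - q'‖

/-- A training dataset of size `n`, with inputs of unit norm and targets in `[-1, 1]^my`. -/
structure Dataset (n mx my : ℕ) where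
  x : Fin n → EuclideanSpace ℝ (Fin mx)
  y : Fin n → EuclideanSpace ℝ (Fin my)
  norm_x : ∀ i, ‖x i‖ ^ 2 = 1
  y_mem : ∀ i k, y i k ∈ Set.Icc (-1 : ℝ) 1

/-- The set of global minimizers of `F`. -/
def argmin {α : Type*} (F : α → ℝ) : Set α := {a | ∀ b, F a ≤ F b}

/-- The loss functional `L(g) = (1/n) ∑ i, ℓ(g(x i), y i)`. -/
def lossFunctional {n mx my : ℕ}
    (ℓ : EuclideanSpace ℝ (Fin my) → EuclideanSpace ℝ (Fin my) → ℝ) (S : Dataset n mx my)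
    (g : EuclideanSpace ℝ (Fin mx) → EuclideanSpace ℝ (Fin my)) : ℝ :=
  (1 / (n : ℝ)) * ∑ i, ℓ (g (S.x i)) (S.y i)

/-- The class of loss functionals on functions `ℝ^mx → ℝ^my` that come from the dataset `S` and a
common loss criterion, and that have a global minimizer. -/
def lossClass {n mx my : ℕ} (ζ : ℝ) (S : Dataset n mx my) :
    Set ((EuclideanSpace ℝ (Fin mx) → EuclideanSpace ℝ (Fin my)) → ℝ) :=
  {L | ∃ ℓ : EuclideanSpace ℝ (Fin my) → EuclideanSpace ℝ (Fin my) → ℝ,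
    (∀ i, IsLossCriterion ζ (fun q => ℓ q (S.y i))) ∧ L = lossFunctional ℓ S ∧
      (argmin L).Nonempty}

/-- A fully connected architecture with `H` hidden layers: the widths `m_0, …, m_{H+1}` of the
layers (values beyond `H + 1` play no role), with `m_0 = mx` and `m_{H+1} = my`. -/
structure Architecture (mx my H : ℕ) where
  m : ℕ → ℕ
  m_zero : m 0 = mx
  m_last : m (H + 1) = my
  m_pos : ∀ l, 1 ≤ l → l ≤ H → 1 ≤ m l

namespace Architecture

variable {mx my H : ℕ} (A : Architecture mx my H)

/-- The total number of trainable parameters. -/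
def numParams : ℕ := ∑ l ∈ Finset.range (H + 1), (A.m l * A.m (l + 1) + A.m (l + 1))

/-- The positions of the entries of `[W, b]`, where `(W, b)` maps layer `l` to layer `l + 1`:
`(i, some j)` is the position of `W i j` and `(i, none)` is that of `b i`. -/
abbrev Block (l : ℕ) : Type := Fin (A.m (l + 1)) × Option (Fin (A.m l))

/-- The positions of all trainable parameters. The block with index `l : Fin (H + 1)` holds the
matrix `[W, b]` of layer number `l + 1`. -/
abbrev Index : Type := Σ l : Fin (H + 1), A.Block l

/-- The space of parameter vectors `θ`, with the Euclidean norm. -/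
abbrev Param : Type := EuclideanSpace ℝ A.Index

/-- The affine map `v ↦ W v + b` of the block `l` of `θ`. -/
def affine (θ : A.Param) (l : Fin (H + 1)) (v : Fin (A.m l) → ℝ) : Fin (A.m (l + 1)) → ℝ :=
  fun i => ∑ j, θ ⟨l, (i, some j)⟩ * v j + θ ⟨l, (i, none)⟩

/-- The output of the `l`-th layer: `x⁽⁰⁾ = x` and
`x⁽ˡ⁺¹⁾ = σ (W⁽ˡ⁺¹⁾ x⁽ˡ⁾ + b⁽ˡ⁺¹⁾) / √(m_{l+1})`. -/
def layer (σ : ℝ → ℝ) (θ : A.Param) (x : EuclideanSpace ℝ (Fin mx)) :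
    (l : ℕ) → l ≤ H → Fin (A.m l) → ℝ
  | 0, _ => fun j => x (Fin.cast A.m_zero j)
  | l + 1, h => fun i =>
      1 / √(A.m (l + 1) : ℝ) *
        σ (A.affine θ ⟨l, by omega⟩ (layer σ θ x l (by omega)) i)

/-- The output `f(x, θ) = W⁽ᴴ⁺¹⁾ x⁽ᴴ⁾ + b⁽ᴴ⁺¹⁾` of the network. -/
def net (σ : ℝ → ℝ) (θ : A.Param) (x : EuclideanSpace ℝ (Fin mx)) : EuclideanSpace ℝ (Fin my) :=
  WithLp.toLp 2 fun k =>
    A.affine θ ⟨H, by omega⟩ (A.layer σ θ x H le_rfl) (Fin.cast A.m_last.symm k)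

/-- The law of the initial parameter vector: independent entries, `N(0, cw)` for the weights and
`N(0, cb)` for the biases (`cw` and `cb` are variances). -/
def initLaw (cw cb : ℝ≥0) : Measure A.Param :=
  (Measure.pi fun p : A.Index => gaussianReal 0 (if p.2.2 = none then cb else cw)).map
    (WithLp.toLp 2)

/-- The training objective `J(θ) = L(f(·, θ))`. -/
def objective (σ : ℝ → ℝ)
    (L : (EuclideanSpace ℝ (Fin mx) → EuclideanSpace ℝ (Fin my)) → ℝ) (θ : A.Param) : ℝ :=
  L (A.net σ θ)

/-- Gradient descent `θᵏ⁺¹ = θᵏ - η ⊙ ∇J(θᵏ)`. -/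
def gd (J : A.Param → ℝ) (η : A.Index → ℝ) (θ₀ : A.Param) : ℕ → A.Param
  | 0 => θ₀
  | k + 1 =>
      gd J η θ₀ k - WithLp.toLp 2 fun p => η p * gradient J (gd J η θ₀ k) p

/-- The parameter vector `θ` with the entries of the block `l` replaced by those of `w`. -/
def replaceBlock (θ : A.Param) (l : Fin (H + 1)) (w : EuclideanSpace ℝ (A.Block l)) : A.Param :=
  WithLp.toLp 2 fun p => if h : p.1 = l then w (h ▸ p.2) else θ p

/-- The entries of the block `l` of `θ`. -/
def block (θ : A.Param) (l : Fin (H + 1)) : EuclideanSpace ℝ (A.Block l) :=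
  WithLp.toLp 2 fun p => θ ⟨l, p⟩

/-- The largest, over the layers, of the squared Frobenius distances from the initial block to the
set of the blocks that minimize `J` when the other layers keep their initial values. A layer for
which there is no such minimizer does not contribute: the value `0` is used for it
(and not the value `∞`, with which a bound in terms of this quantity would be void). -/
def initRadius (J : A.Param → ℝ) (θ₀ : A.Param) : ℝ :=
  ⨆ l : Fin (H + 1),
    sInf ((fun w => ‖w - A.block θ₀ l‖ ^ 2) '' argmin fun w => J (A.replaceBlock θ₀ l w))

end Architecture

/-- Probable trainability with `d` parameters, for `n` samples, `H` hidden layers and failure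
probability `δ`; `C` is the implied constant in the bound `O(c_r ζ / ε)` on the number of steps.
The probability of the complement is an outer probability, hence the event contains a measurable
one of probability at least `1 - δ`. -/
def ProbablyTrainable (σ : ℝ → ℝ) (cw cb : ℝ≥0) (mx my : ℕ) (C : ℝ) (n H : ℕ) (δ : ℝ) (d : ℕ) :
    Prop :=
  ∀ ζ : ℝ, 0 < ζ →
    ∃ A : Architecture mx my H, A.numParams ≤ d ∧ ∃ η : A.Index → ℝ,
      ∀ S : Dataset n mx my, ∀ L ∈ lossClass ζ S, ∃ cθ : ℝ, ∀ ε : ℝ, 0 < ε →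
        A.initLaw cw cb {θ₀ | ¬ ∃ t : ℕ,
          (t : ℝ) ≤ C * (A.initRadius (A.objective σ L) θ₀ * ζ / ε) ∧
          (∀ fstar ∈ argmin L,
            A.objective σ L (A.gd (A.objective σ L) η θ₀ t) ≤ L fstar + ε) ∧
          ‖A.gd (A.objective σ L) η θ₀ t‖ ^ 2 ≤ cθ} ≤ ENNReal.ofReal δ

end DeepNet

end

/-! Only the last layer is trained, in a network with hidden widths `1, …, 1, n`: the step size is a
constant on the last block and zero elsewhere. All other layers keep their random initial values, so
the objective becomes a mean of convex losses composed with linear maps of the last block, and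
gradient descent on it is smooth convex optimization.

Three facts make this work. Expressivity: the determinant of the Gram matrix of the last hidden
features at the distinct inputs is analytic in the parameters and nonzero for one explicit choice,
hence almost surely nonzero at initialization (`ae_featureGram_det_ne_zero`). The last block can
then reproduce the values of a global minimizer of the loss at all inputs, so the restricted problem
has the optimal value `L(f*)`. Smoothness: the gradient in the last block is `ζ (B + 1)`-Lipschitz,
where `B` bounds the mean squared feature norm. Markov's inequality, applied to second moments of
the Gaussian weights, gives such a `B` depending only on `σ, cw, cb, H, δ`, outside an event of
probability at most `δ / 2` (`initLaw_hiddenSize_le`, `mean_sum_layer_sq_le`). Convergence: the `O(1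
/ t)` rate for convex functions gives the bound on the number of steps, since `c_r` dominates the
squared distance from the initial last block to its minimizers (`exists_gd_le`). Iterates never move
away from a minimizer, so their norm is bounded by a finite measurable function of the
initialization, which yields `c_θ` outside another event of probability at most `δ / 2`.

The parameter count is about `m_x + 2H + 2n + n m_y`, well within the budget (`thin_size_le`). -/

namespace DeepNet

/-! ### Gradient descent for smooth convex functions. -/

section GradientDescent

variable {E : Type*} [NormedAddCommGroup E] [InnerProductSpace ℝ E] [CompleteSpace E]

lemma hasDerivAt_comp_line {f : E → ℝ} (hf : Differentiable ℝ f) (x v : E) (t : ℝ) :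
    HasDerivAt (fun t : ℝ => f (x + t • v)) (inner ℝ (gradient f (x + t • v)) v) t := by
  have h2 : HasDerivAt (fun t : ℝ => x + t • v) v t := by
    simpa using ((hasDerivAt_id t).smul_const v).const_add x
  have := (hf (x + t • v)).hasFDerivAt.comp_hasDerivAt t h2
  rwa [← inner_gradient_left] at this

/-- The quadratic upper bound for a function with Lipschitz gradient. -/
lemma le_quadratic_of_lipschitz_gradient {f : E → ℝ} (hf : Differentiable ℝ f) {M : ℝ}
    (hM : ∀ x y, ‖gradient f x - gradient f y‖ ≤ M * ‖x - y‖) (x v : E) :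
    f (x + v) ≤ f x + inner ℝ (gradient f x) v + M / 2 * ‖v‖ ^ 2 := by
  -- `ψ 1 ≤ ψ 0` is the claim. The derivative of `ψ` is nonpositive on the unit interval because the
  -- gradient at `x + t • v` differs from that at `x` by at most `M t ‖v‖`.
  set ψ : ℝ → ℝ := fun t =>
    f (x + t • v) - t * inner ℝ (gradient f x) v - t ^ 2 * (M / 2 * ‖v‖ ^ 2) with hψ
  have hd : ∀ t, HasDerivAt ψ (inner ℝ (gradient f (x + t • v)) v - inner ℝ (gradient f x) v
      - 2 * t * (M / 2 * ‖v‖ ^ 2)) t := by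
    intro t
    have h1 := hasDerivAt_comp_line hf x v t
    have h2 := (hasDerivAt_id t).mul_const (inner ℝ (gradient f x) v)
    have h3 := (hasDerivAt_pow 2 t).mul_const (M / 2 * ‖v‖ ^ 2)
    exact ((h1.sub h2).sub h3).congr_deriv (by simp)
  have hanti : AntitoneOn ψ (Set.Icc 0 1) := by
    apply antitoneOn_of_deriv_nonpos (convex_Icc 0 1)
    · exact fun t _ => (hd t).continuousAt.continuousWithinAt
    · exact fun t _ => (hd t).differentiableAt.differentiableWithinAt
    · intro t ht
      rw [interior_Icc] at ht
      rw [(hd t).deriv, ← inner_sub_left]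
      have h1 := real_inner_le_norm (gradient f (x + t • v) - gradient f x) v
      have h2 := hM (x + t • v) x
      rw [add_sub_cancel_left, norm_smul, Real.norm_of_nonneg ht.1.le] at h2
      have h3 := mul_le_mul_of_nonneg_right h2 (norm_nonneg v)
      nlinarith
  have := hanti (Set.left_mem_Icc.2 zero_le_one) (Set.right_mem_Icc.2 zero_le_one) zero_le_one
  simp only [hψ, one_smul, zero_smul, add_zero, one_mul, zero_mul, one_pow, sub_zero,
    ne_eq, OfNat.ofNat_ne_zero, not_false_eq_true, zero_pow] at this
  linarith

/-- The tangent lower bound for a differentiable convex function. -/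
lemma add_inner_gradient_le_of_convexOn {f : E → ℝ} (hf : Differentiable ℝ f)
    (hc : ConvexOn ℝ Set.univ f) (x y : E) :
    f x + inner ℝ (gradient f x) (y - x) ≤ f y := by
  have hc' : ConvexOn ℝ Set.univ (fun t : ℝ => f (x + t • (y - x))) := by
    have := hc.comp_affineMap (AffineMap.lineMap x y)
    refine this.congr (fun t _ => ?_)
    simp [AffineMap.lineMap_apply, add_comm]
  have hd := hasDerivAt_comp_line hf x (y - x) 0
  have := hc'.le_slope_of_hasDerivAt (Set.mem_univ 0) (Set.mem_univ 1) zero_lt_one hd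
  simp only [slope_def_field, one_smul, zero_smul, add_zero, sub_zero, div_one,
    add_sub_cancel] at this
  linarith

lemma sub_le_of_minimizer {f : E → ℝ} (hf : Differentiable ℝ f) {M : ℝ}
    (hM : ∀ x y, ‖gradient f x - gradient f y‖ ≤ M * ‖x - y‖) {z : E} (hz : z ∈ argmin f) (x : E) :
    f x - f z ≤ M / 2 * ‖z - x‖ ^ 2 := by
  have h0 : gradient f z = 0 := by
    have : IsLocalMin f z := Eventually.of_forall hz
    rw [gradient, this.fderiv_eq_zero, map_zero]
  have := le_quadratic_of_lipschitz_gradient hf hM z (x - z)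
  rw [h0, inner_zero_left, add_sub_cancel, norm_sub_rev] at this
  linarith

/-- The potential that yields the `O(1 / t)` rate of gradient descent. -/
lemma gradient_descent_potential {f : E → ℝ} (hf : Differentiable ℝ f)
    (hc : ConvexOn ℝ Set.univ f) {M : ℝ} (hM0 : 0 < M)
    (hM : ∀ x y, ‖gradient f x - gradient f y‖ ≤ M * ‖x - y‖) {w : ℕ → E}
    (hw : ∀ t, w (t + 1) = w t - M⁻¹ • gradient f (w t)) (z : E) (t : ℕ) :
    ‖z - w t‖ ^ 2 + 2 / M * t * (f (w t) - f z) ≤ ‖z - w 0‖ ^ 2 := by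
  induction t with
  | zero => simp
  | succ t ih =>
    refine le_trans ?_ ih
    set g := gradient f (w t) with hg
    have h1 := le_quadratic_of_lipschitz_gradient hf hM (w t) (-(M⁻¹ • g))
    rw [← sub_eq_add_neg, ← hw, ← hg, inner_neg_right, inner_smul_right,
      real_inner_self_eq_norm_sq, norm_neg, norm_smul, mul_pow, Real.norm_of_nonneg
      (inv_nonneg.2 hM0.le)] at h1
    have h2 := add_inner_gradient_le_of_convexOn hf hc (w t) z
    rw [← hg] at h2
    have h3 : ‖z - w (t + 1)‖ ^ 2
        = ‖z - w t‖ ^ 2 + 2 * M⁻¹ * inner ℝ g (z - w t) + M⁻¹ ^ 2 * ‖g‖ ^ 2 := by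
      rw [hw, sub_sub_eq_add_sub, add_sub_right_comm, norm_add_sq_real, ← hg, inner_smul_right,
        real_inner_comm, norm_smul, mul_pow, Real.norm_of_nonneg (inv_nonneg.2 hM0.le)]
      ring
    have h4 : M * M⁻¹ = 1 := mul_inv_cancel₀ hM0.ne'
    have h5 : 0 < M⁻¹ := inv_pos.2 hM0
    -- This guaranteed decrease, multiplied by `2 / M`, exactly cancels the term `‖g‖ ^ 2 / M ^ 2`
    -- in the expansion `h3`. Convexity (`h2`) handles the inner product, and monotonicity (`h7`)
    -- the factor `t` of the old gap.
    have h6 : f (w (t + 1)) ≤ f (w t) - M⁻¹ / 2 * ‖g‖ ^ 2 := by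
      have : M / 2 * (M⁻¹ ^ 2 * ‖g‖ ^ 2) = M⁻¹ / 2 * ‖g‖ ^ 2 := by
        field_simp
      rw [this] at h1
      linarith
    have h7 : f (w (t + 1)) ≤ f (w t) := by
      have := mul_nonneg h5.le (sq_nonneg ‖g‖)
      linarith
    have h8 : M⁻¹ * (t : ℝ) * (f (w (t + 1))) ≤ M⁻¹ * t * f (w t) :=
      mul_le_mul_of_nonneg_left h7 (by positivity)
    have h9 := mul_le_mul_of_nonneg_left h2 h5.le
    have h10 := mul_le_mul_of_nonneg_left h6 h5.le
    rw [h3, div_eq_mul_inv]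
    push_cast
    nlinarith

end GradientDescent

/-! ### Null zero sets of analytic functions. -/

section AnalyticZeros

lemma ae_ne_zero_of_analytic_real {g : ℝ → ℝ} (hg : AnalyticOnNhd ℝ g Set.univ) {x : ℝ}
    (hx : g x ≠ 0) (μ : Measure ℝ) [NullSingletonClass μ] : ∀ᵐ y ∂μ, g y ≠ 0 := by
  have h := hg.preimage_zero_mem_codiscrete hx
  have := ae_restrict_le_codiscreteWithin (μ := μ) (U := Set.univ) MeasurableSet.univ
  rw [Measure.restrict_univ] at this
  exact this h

/-- Induction on the dimension with Fubini. With the other coordinates frozen at those of `x`, the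
one-variable case shows that almost every first coordinate gives a slice that is not identically
zero, and the induction hypothesis applies to that slice. -/
lemma ae_ne_zero_of_analytic_fin {N : ℕ} (μ : Fin N → Measure ℝ) [∀ i, SigmaFinite (μ i)]
    [∀ i, NullSingletonClass (μ i)] {g : (Fin N → ℝ) → ℝ} (hg : AnalyticOnNhd ℝ g Set.univ)
    {x : Fin N → ℝ} (hx : g x ≠ 0) : ∀ᵐ y ∂Measure.pi μ, g y ≠ 0 := by
  induction N with
  | zero => exact Eventually.of_forall fun y => by rwa [Subsingleton.elim y x]
  | succ N ih =>
    have hmp := measurePreserving_piFinSuccAbove μ 0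
    have hcont : Continuous g := continuous_iff_continuousAt.2 fun y => (hg y trivial).continuousAt
    have hcons : ∀ p : ℝ × (Fin N → ℝ), AnalyticAt ℝ (fun p : ℝ × (Fin N → ℝ) =>
        (Fin.cons p.1 p.2 : Fin (N + 1) → ℝ)) p := by
      intro p
      refine AnalyticAt.pi fun i => ?_
      refine Fin.cases ?_ (fun i => ?_) i
      · simpa using analyticAt_fst
      · simpa using ((ContinuousLinearMap.proj (R := ℝ) (φ := fun _ : Fin N => ℝ) i).analyticAt
          p.2).fun_comp (f := Prod.snd) analyticAt_snd
    have hG : ∀ p, AnalyticAt ℝ (fun p : ℝ × (Fin N → ℝ) =>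
        g (Fin.cons p.1 p.2 : Fin (N + 1) → ℝ)) p :=
      fun p => (hg _ trivial).fun_comp (hcons p)
    have hGc : Continuous (fun p : ℝ × (Fin N → ℝ) => g (Fin.cons p.1 p.2 : Fin (N + 1) → ℝ)) :=
      continuous_iff_continuousAt.2 fun y => (hG y).continuousAt
    have key : ∀ᵐ p ∂((μ 0).prod (Measure.pi fun j => μ (Fin.succAbove 0 j))),
        g (Fin.cons p.1 p.2 : Fin (N + 1) → ℝ) ≠ 0 := by
      rw [ae_iff]
      have hms : MeasurableSet {p : ℝ × (Fin N → ℝ) |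
          ¬ g (Fin.cons p.1 p.2 : Fin (N + 1) → ℝ) ≠ 0} := by
        simp only [ne_eq, not_not]
        exact (isClosed_singleton (x := (0 : ℝ))).preimage hGc |>.measurableSet
      rw [Measure.measure_prod_null hms]
      have h1 : ∀ᵐ a ∂(μ 0), g (Fin.cons a (Fin.tail x) : Fin (N + 1) → ℝ) ≠ 0 := by
        refine ae_ne_zero_of_analytic_real (x := x 0) (fun a _ => ?_) ?_ _
        · exact (hG (a, Fin.tail x)).comp₂ (f := fun a => a) (g := fun _ => Fin.tail x)
            analyticAt_id analyticAt_const
        · simpa using hx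
      filter_upwards [h1] with a ha
      have := ih (fun j => μ (Fin.succAbove 0 j))
        (g := fun v => g (Fin.cons a v : Fin (N + 1) → ℝ)) (fun v _ =>
          (hG (a, v)).comp₂ (f := fun _ => a) (g := fun v => v)
            analyticAt_const analyticAt_id) ha
      rw [ae_iff] at this
      exact this
    have h2 := hmp.quasiMeasurePreserving.ae key
    filter_upwards [h2] with y hy
    convert hy using 2
    simp [MeasurableEquiv.piFinSuccAbove, Fin.insertNthEquiv]

/-- The zero set of a nonzero analytic function is null for a product of atomless measures. -/
theorem ae_ne_zero_of_analytic {ι : Type*} [Fintype ι] (μ : ι → Measure ℝ)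
    [∀ i, SigmaFinite (μ i)] [∀ i, NullSingletonClass (μ i)] {g : (ι → ℝ) → ℝ}
    (hg : AnalyticOnNhd ℝ g Set.univ) {x : ι → ℝ} (hx : g x ≠ 0) :
    ∀ᵐ y ∂Measure.pi μ, g y ≠ 0 := by
  let e := (Fintype.equivFin ι).symm
  have hmp := measurePreserving_piCongrLeft μ e
  have hk := ae_ne_zero_of_analytic_fin (fun i => μ (e i)) (g := fun v => g (fun i => v (e.symm i)))
    (x := fun i => x (e i)) (fun v _ => (hg _ trivial).fun_comp (AnalyticAt.pi fun i =>
      (ContinuousLinearMap.proj (R := ℝ) (φ := fun _ : Fin _ => ℝ) (e.symm i)).analyticAt _))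
    (by simpa using hx)
  have h2 := hmp.symm.quasiMeasurePreserving.ae hk
  filter_upwards [h2] with y hy
  convert hy using 2
  funext i
  simp [MeasurableEquiv.piCongrLeft, Equiv.piCongrLeft]

end AnalyticZeros


/-! ### Linear independence of ridge functions. -/

section Ridge

/-- The ridge functions `(w, b) ↦ σ (w z + b)` at distinct points `z` are linearly independent. -/
lemma eq_zero_of_ridge_sum_eq_zero {σ : ℝ → ℝ} (hσ : IsActivation σ) {ι : Type*} [Fintype ι]
    {z : ι → ℝ} (hz : Function.Injective z) {c : ι → ℝ}
    (h : ∀ w b : ℝ, ∑ i, c i * σ (w * z i + b) = 0) : c = 0 := by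
  classical
  by_contra hc
  obtain ⟨i₁, hi₁⟩ := Function.ne_iff.1 hc
  -- Take the largest point that carries a nonzero coefficient. Along `b = s - w z k` with `w → ∞`,
  -- its argument stays at `s`, while the arguments at the other points with nonzero coefficients
  -- tend to `-∞`, where `σ` has the finite limit `a`.
  obtain ⟨k, hk, hmax⟩ := (Finset.univ.filter fun i => c i ≠ 0).exists_max_image z
    ⟨i₁, by simpa using hi₁⟩
  obtain ⟨a, ha⟩ := hσ.limit_bot
  have hlim : ∀ s : ℝ, ∑ i, (if i = k then c i * σ s else c i * a) = 0 := by
    intro s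
    have ht : Tendsto (fun w : ℝ => ∑ i, c i * σ (w * z i + (s - w * z k))) atTop
        (𝓝 (∑ i, (if i = k then c i * σ s else c i * a))) := by
      refine tendsto_finsetSum _ fun i _ => ?_
      by_cases hik : i = k
      · subst hik
        simp
      rw [if_neg hik]
      by_cases hci : c i = 0
      · simp [hci]
      have hlt : z i - z k < 0 := by
        have h1 := hmax i (by simpa using hci)
        have h2 : z i ≠ z k := fun h => hik (hz h)
        have := lt_of_le_of_ne h1 h2
        linarith
      refine (ha.comp ?_).const_mul _
      have h3 : Tendsto (fun w : ℝ => w * (z i - z k) + s) atTop atBot :=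
        tendsto_atBot_add_const_right _ _ (tendsto_id.atTop_mul_const_of_neg hlt)
      refine h3.congr fun w => ?_
      ring
    have h0 : (fun w : ℝ => ∑ i, c i * σ (w * z i + (s - w * z k))) = fun _ => 0 :=
      funext fun w => h _ _
    rw [h0] at ht
    exact tendsto_nhds_unique ht tendsto_const_nhds |>.symm ▸ rfl
  -- Only the term of `k` depends on `s`, so comparing two values of `s` contradicts strict
  -- monotonicity.
  have h1 := hlim 0
  have h2 := hlim 1
  rw [← Finset.add_sum_erase _ _ (Finset.mem_univ k), if_pos rfl] at h1 h2
  have h3 : ∀ s : ℝ, ∑ i ∈ Finset.univ.erase k, (if i = k then c i * σ s else c i * a)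
      = ∑ i ∈ Finset.univ.erase k, c i * a := fun s =>
    Finset.sum_congr rfl fun i hi => if_neg (Finset.ne_of_mem_erase hi)
  rw [h3] at h1 h2
  have hne : σ 0 < σ 1 := hσ.increasing zero_lt_one
  have hck : c k ≠ 0 := by simpa using hk
  have : c k * σ 0 = c k * σ 1 := by linarith
  exact hne.ne (mul_left_cancel₀ hck this)

/-- A set of vectors with trivial orthogonal complement contains a family of any size at least the
dimension with the same property. -/
lemma exists_fin_family_of_separating {ι : Type*} [Fintype ι] {s : Set (ι → ℝ)} (hs : s.Nonempty)
    (h : ∀ c : ι → ℝ, (∀ v ∈ s, ∑ i, c i * v i = 0) → c = 0) {m : ℕ} (hm : Fintype.card ι ≤ m) :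
    ∃ p : Fin m → ι → ℝ, (∀ j, p j ∈ s) ∧
      ∀ c : ι → ℝ, (∀ j, ∑ i, c i * p j i = 0) → c = 0 := by
  obtain ⟨f, hf, hspan, -⟩ := Submodule.exists_fun_fin_finrank_span_eq ℝ s
  obtain ⟨v₀, hv₀⟩ := hs
  have hr : Module.finrank ℝ (Submodule.span ℝ s) ≤ m :=
    (Submodule.finrank_le _).trans (by simpa using hm)
  -- A basis of the span chosen inside `s`, padded with an arbitrary element of `s` to reach size
  -- `m`.
  refine ⟨fun j => if h : j.1 < Module.finrank ℝ (Submodule.span ℝ s) then f ⟨j, h⟩ else v₀,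
    fun j => ?_, fun c hc => h c fun v hv => ?_⟩
  · dsimp only
    split_ifs
    exacts [hf _, hv₀]
  · have hv' : v ∈ Submodule.span ℝ (Set.range f) := by
      rw [hspan]
      exact Submodule.subset_span hv
    clear hv
    induction hv' using Submodule.span_induction with
    | mem x hx =>
      obtain ⟨r, rfl⟩ := hx
      simpa using hc ⟨r, r.2.trans_le hr⟩
    | zero => simp
    | add x y _ _ hx hy => simp only [Pi.add_apply, mul_add, Finset.sum_add_distrib, hx, hy, add_zero]
    | smul a x _ hx =>
      have : ∑ i, c i * (a • x) i = a * ∑ i, c i * x i := by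
        rw [Finset.mul_sum]
        exact Finset.sum_congr rfl fun i _ => by simp; ring
      rw [this, hx, mul_zero]

lemma exists_separating_neurons {σ : ℝ → ℝ} (hσ : IsActivation σ) {ι : Type*} [Fintype ι]
    {z : ι → ℝ} (hz : Function.Injective z) {m : ℕ} (hm : Fintype.card ι ≤ m) :
    ∃ w b : Fin m → ℝ, ∀ c : ι → ℝ, (∀ j, ∑ i, c i * σ (w j * z i + b j) = 0) → c = 0 := by
  obtain ⟨p, hp, hp'⟩ := exists_fin_family_of_separating
    (s := Set.range fun q : ℝ × ℝ => fun i => σ (q.1 * z i + q.2)) (Set.range_nonempty _)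
    (fun c hc => eq_zero_of_ridge_sum_eq_zero hσ hz fun w b => hc _ ⟨(w, b), rfl⟩) hm
  choose q hq using hp
  refine ⟨fun j => (q j).1, fun j => (q j).2, fun c hc => hp' c fun j => ?_⟩
  rw [← hq j]
  exact hc j

/-- Finitely many distinct points are separated by a linear functional. -/
lemma exists_injective_functional {ι : Type*} [Finite ι] {k : ℕ}
    {X : ι → EuclideanSpace ℝ (Fin k)} (hX : Function.Injective X) :
    ∃ u : Fin k → ℝ, Function.Injective fun a => ∑ j, u j * X a j := by
  classical
  obtain ⟨f, hf⟩ := Module.exists_dual_forall_apply_ne_zero (K := ℝ)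
    (fun p : {p : ι × ι // p.1 ≠ p.2} => X p.1.1 - X p.1.2)
    (fun p => sub_ne_zero.2 fun h => p.2 (hX h))
  refine ⟨fun j => f (EuclideanSpace.single j 1), fun a b hab => ?_⟩
  by_contra hne
  refine hf ⟨(a, b), hne⟩ ?_
  have key : ∀ v : EuclideanSpace ℝ (Fin k), f v = ∑ j, f (EuclideanSpace.single j 1) * v j := by
    intro v
    conv_lhs => rw [← (EuclideanSpace.basisFun (Fin k) ℝ).sum_repr v]
    rw [map_sum]
    exact Finset.sum_congr rfl fun j _ => by simp [mul_comm]
  simp only [map_sub]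
  rw [key, key]
  exact sub_eq_zero.2 hab

end Ridge

/-! ### Almost sure linear independence of the last hidden features. -/

namespace Architecture

variable {mx my H : ℕ} (A : Architecture mx my H)

lemma analyticAt_param_apply (p : A.Index) (θ : A.Param) :
    AnalyticAt ℝ (fun θ : A.Param => θ p) θ :=
  (EuclideanSpace.proj (𝕜 := ℝ) p : A.Param →L[ℝ] ℝ).analyticAt θ

lemma analyticAt_affine {l : Fin (H + 1)} {v : A.Param → Fin (A.m l) → ℝ} {θ : A.Param}
    (hv : ∀ j, AnalyticAt ℝ (fun θ => v θ j) θ) (i : Fin (A.m (l + 1))) :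
    AnalyticAt ℝ (fun θ => A.affine θ l (v θ) i) θ := by
  unfold affine
  have h : AnalyticAt ℝ (fun θ : A.Param => ∑ j, θ ⟨l, (i, some j)⟩ * v θ j) θ :=
    Finset.analyticAt_fun_sum _ fun j _ => (A.analyticAt_param_apply _ θ).fun_mul (hv j)
  exact h.fun_add (A.analyticAt_param_apply _ θ)

lemma analyticAt_layer {σ : ℝ → ℝ} (hσ : AnalyticOnNhd ℝ σ Set.univ)
    (x : EuclideanSpace ℝ (Fin mx)) (θ : A.Param) : ∀ (l : ℕ) (h : l ≤ H) (i : Fin (A.m l)),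
      AnalyticAt ℝ (fun θ : A.Param => A.layer σ θ x l h i) θ
  | 0, _, _ => by
    simp only [layer]
    exact analyticAt_const
  | l + 1, h, i => by
    simp only [layer]
    exact analyticAt_const.fun_mul ((hσ _ trivial).fun_comp
      (A.analyticAt_affine (l := ⟨l, by omega⟩)
        (fun j => analyticAt_layer hσ x θ l (by omega) j) i))

lemma differentiable_net {σ : ℝ → ℝ} (hσ : AnalyticOnNhd ℝ σ Set.univ)
    (x : EuclideanSpace ℝ (Fin mx)) : Differentiable ℝ fun θ : A.Param => A.net σ θ x := by
  rw [differentiable_euclidean]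
  intro k θ
  exact (A.analyticAt_affine (l := ⟨H, by omega⟩)
    (fun j => A.analyticAt_layer hσ x θ H le_rfl j) _).differentiableAt

/-- The Gram matrix of the last hidden features at a family of inputs. -/
noncomputable def featureGram (σ : ℝ → ℝ) {ι : Type*} (X : ι → EuclideanSpace ℝ (Fin mx))
    (θ : A.Param) : Matrix ι ι ℝ :=
  Matrix.of fun a b => ∑ j, A.layer σ θ (X a) H le_rfl j * A.layer σ θ (X b) H le_rfl j

lemma analyticAt_featureGram_det {σ : ℝ → ℝ} (hσ : AnalyticOnNhd ℝ σ Set.univ) {ι : Type*}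
    [Fintype ι] [DecidableEq ι] (X : ι → EuclideanSpace ℝ (Fin mx)) (θ : A.Param) :
    AnalyticAt ℝ (fun θ => (A.featureGram σ X θ).det) θ := by
  simp only [Matrix.det_apply']
  refine Finset.analyticAt_fun_sum _ fun τ _ => analyticAt_const.fun_mul
    (Finset.analyticAt_fun_prod _ fun a _ => ?_)
  simp only [featureGram, Matrix.of_apply]
  exact Finset.analyticAt_fun_sum _ fun j _ => (A.analyticAt_layer hσ _ θ H le_rfl j).fun_mul
    (A.analyticAt_layer hσ _ θ H le_rfl j)

/-- For a vector `c` in the kernel, the quadratic form of the Gram matrix is a sum over neurons of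
the squares of the combinations in `h`, so all of them vanish. -/
lemma featureGram_det_ne_zero {σ : ℝ → ℝ} {ι : Type*} [Fintype ι] [DecidableEq ι]
    {X : ι → EuclideanSpace ℝ (Fin mx)} {θ : A.Param}
    (h : ∀ c : ι → ℝ, (∀ j, ∑ a, c a * A.layer σ θ (X a) H le_rfl j = 0) → c = 0) :
    (A.featureGram σ X θ).det ≠ 0 := by
  intro h0
  obtain ⟨c, hc, hc0⟩ := Matrix.exists_vecMul_eq_zero_iff.2 h0
  refine hc (h c ?_)
  have hsq : ∑ j, (∑ a, c a * A.layer σ θ (X a) H le_rfl j) ^ 2 = 0 := by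
    have : ∑ b, (Matrix.vecMul c (A.featureGram σ X θ)) b * c b = 0 := by simp [hc0]
    rw [← this]
    simp only [Matrix.vecMul, dotProduct, featureGram, Matrix.of_apply, Finset.mul_sum,
      Finset.sum_mul, sq]
    rw [Finset.sum_comm]
    simp only [Finset.sum_comm (s := (Finset.univ : Finset (Fin (A.m H)))) (t := Finset.univ (α := ι))]
    refine Finset.sum_congr rfl fun a _ => Finset.sum_congr rfl fun b _ =>
      Finset.sum_congr rfl fun j _ => ?_
    ring
  intro j
  have := (Finset.sum_eq_zero_iff_of_nonneg fun j _ => sq_nonneg _).1 hsq j (Finset.mem_univ j)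
  simpa using this

/-- The common value of the neurons of layer `l` when the neurons of the first layer compute
`σ (u · x)` and the later weights are `1`. -/
noncomputable def tiedLayer (m : ℕ → ℕ) (σ : ℝ → ℝ) (u : ℝ) : ℕ → ℝ
  | 0 => u
  | 1 => 1 / √(m 1 : ℝ) * σ u
  | l + 2 => 1 / √(m (l + 2) : ℝ) * σ (m (l + 1) * tiedLayer m σ u (l + 1))

lemma tiedLayer_injective {σ : ℝ → ℝ} (hσ : Function.Injective σ) {ι : Type*} {u : ι → ℝ}
    (hu : Function.Injective u) (l : ℕ) (hl : l ≤ H) :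
    Function.Injective fun a => tiedLayer A.m σ (u a) l := by
  have hs : ∀ l, 1 ≤ l → l ≤ H → (1 / √(A.m l : ℝ)) ≠ 0 := fun l h1 h2 => by
    have := A.m_pos l h1 h2
    positivity
  induction l with
  | zero => exact hu
  | succ l ih =>
    cases l with
    | zero => exact fun a b h => hu (hσ (mul_left_cancel₀ (hs 1 le_rfl hl) h))
    | succ l =>
      have hm : (A.m (l + 1) : ℝ) ≠ 0 := by
        have := A.m_pos (l + 1) (by omega) (by omega)
        positivity
      exact fun a b h => ih (by omega) (mul_left_cancel₀ hm
        (hσ (mul_left_cancel₀ (hs (l + 2) (by omega) hl) h)))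

/-- A linear functional `u` separates the inputs. All layers below the last hidden one transmit an
injective function of `u · x`, identical in all their neurons; this works at any width. The last
hidden layer then consists of ridge neurons at distinct real points, which separate coefficient
vectors by `exists_separating_neurons`. -/
lemma exists_featureGram_det_ne_zero {σ : ℝ → ℝ} (hσ : IsActivation σ) (hH : 2 ≤ H) {ι : Type*}
    [Fintype ι] [DecidableEq ι] {X : ι → EuclideanSpace ℝ (Fin mx)} (hX : Function.Injective X)
    (hm : Fintype.card ι ≤ A.m H) : ∃ θ : A.Param, (A.featureGram σ X θ).det ≠ 0 := by
  obtain ⟨u, hu⟩ := exists_injective_functional hX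
  set U : ι → ℝ := fun a => ∑ j, u j * X a j with hU
  obtain ⟨h, rfl⟩ : ∃ h, H = h + 2 := ⟨H - 2, by omega⟩
  have hmpos : ∀ l, 1 ≤ l → l ≤ h + 2 → (A.m l : ℝ) ≠ 0 := fun l h1 h2 => by
    have := A.m_pos l h1 h2
    positivity
  have hz : Function.Injective fun a => (A.m (h + 1) : ℝ) * tiedLayer A.m σ (U a) (h + 1) :=
    fun a b hab => A.tiedLayer_injective hσ.increasing.injective hu (h + 1) (by omega)
      (mul_left_cancel₀ (hmpos _ (by omega) (by omega)) hab)
  obtain ⟨w, b, hwb⟩ := exists_separating_neurons hσ hz hm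
  -- Block `0` computes `u · x`, blocks `1, …, h` sum their inputs, and block `h + 1` holds the
  -- ridge parameters `(w, b)`. The out-of-range defaults only serve to avoid transport along
  -- equalities of widths.
  let θ : A.Param := WithLp.toLp 2 fun p =>
    if p.1.1 = 0 then p.2.2.elim 0 fun j => if hj : j.1 < mx then u ⟨j, hj⟩ else 0
    else if p.1.1 = h + 1 then
      p.2.2.elim (if hi : p.2.1.1 < A.m (h + 2) then b ⟨p.2.1, hi⟩ else 0)
        fun _ => if hi : p.2.1.1 < A.m (h + 2) then w ⟨p.2.1, hi⟩ else 0
    else p.2.2.elim 0 fun _ => 1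
  have hW₀ : ∀ (i : Fin (A.m 1)) (j : Fin (A.m 0)),
      θ ⟨⟨0, by omega⟩, (i, some j)⟩ = u (Fin.cast A.m_zero j) := fun i j => by
    have : j.1 < mx := j.2.trans_eq A.m_zero
    simp [θ, this]
    rfl
  have hb₀ : ∀ i : Fin (A.m 1), θ ⟨⟨0, by omega⟩, (i, none)⟩ = 0 := fun i => by simp [θ]
  have hW : ∀ l (_ : l ≠ 0) (_ : l < h + 1) (i : Fin (A.m (l + 1))) (j : Fin (A.m l)),
      θ ⟨⟨l, by omega⟩, (i, some j)⟩ = 1 := fun l h0 h1 i j => by simp [θ, h0, h1.ne]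
  have hb : ∀ l (_ : l ≠ 0) (_ : l < h + 1) (i : Fin (A.m (l + 1))),
      θ ⟨⟨l, by omega⟩, (i, none)⟩ = 0 := fun l h0 h1 i => by simp [θ, h0, h1.ne]
  have hWl : ∀ (i : Fin (A.m (h + 2))) (j : Fin (A.m (h + 1))),
      θ ⟨⟨h + 1, by omega⟩, (i, some j)⟩ = w i := fun i j => by simp [θ]
  have hbl : ∀ (i : Fin (A.m (h + 2))), θ ⟨⟨h + 1, by omega⟩, (i, none)⟩ = b i :=
    fun i => by simp [θ]
  clear_value θ
  have hlow : ∀ a l (hl : l + 1 ≤ h + 1) i,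
      A.layer σ θ (X a) (l + 1) (by omega) i = tiedLayer A.m σ (U a) (l + 1) := by
    intro a l
    induction l with
    | zero =>
      intro hl i
      have : ∑ j : Fin (A.m 0), u (Fin.cast A.m_zero j) * X a (Fin.cast A.m_zero j) = U a :=
        Fintype.sum_equiv (finCongr A.m_zero) _ _ fun j => rfl
      simp only [layer, tiedLayer, affine]
      rw [hb₀, add_zero, ← this]
      congr 2
      exact Finset.sum_congr rfl fun j _ => by rw [hW₀]
    | succ l ih =>
      intro hl i
      have haff : A.affine θ ⟨l + 1, by omega⟩ (A.layer σ θ (X a) (l + 1) (by omega)) i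
          = A.m (l + 1) * tiedLayer A.m σ (U a) (l + 1) := by
        simp only [affine, ih (by omega)]
        rw [hb _ (by omega) (by omega), add_zero,
          Finset.sum_congr rfl fun j _ => by rw [hW _ (by omega) (by omega), one_mul]]
        simp
      rw [layer, tiedLayer]
      beta_reduce
      rw [haff]
  refine ⟨θ, A.featureGram_det_ne_zero fun c hc => hwb c fun i => ?_⟩
  have hci := hc i
  have hlast : ∀ a, A.layer σ θ (X a) (h + 2) le_rfl i = 1 / √(A.m (h + 2) : ℝ) *
      σ (w i * (A.m (h + 1) * tiedLayer A.m σ (U a) (h + 1)) + b i) := by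
    intro a
    have h2 := hlow a h le_rfl
    rw [layer]
    simp only [affine, h2, hWl, hbl]
    simp only [Finset.sum_const, Finset.card_univ, Fintype.card_fin, nsmul_eq_mul]
    ring_nf
  have hs : (1 / √(A.m (h + 2) : ℝ)) ≠ 0 := by
    have := A.m_pos (h + 2) (by omega) le_rfl
    positivity
  refine mul_left_cancel₀ hs ?_
  rw [mul_zero, ← hci, Finset.mul_sum]
  refine Finset.sum_congr rfl fun a _ => ?_
  rw [hlast]
  ring

instance (cw cb : ℝ≥0) : IsProbabilityMeasure (A.initLaw cw cb) :=
  Measure.isProbabilityMeasure_map (WithLp.measurable_toLp 2 _).aemeasurable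

/-- At distinct inputs, the last hidden features are almost surely linearly independent. -/
lemma ae_featureGram_det_ne_zero {σ : ℝ → ℝ} (hσ : IsActivation σ) (hH : 2 ≤ H) {cw cb : ℝ≥0}
    (hcw : 0 < cw) (hcb : 0 < cb) {ι : Type*} [Fintype ι] [DecidableEq ι]
    {X : ι → EuclideanSpace ℝ (Fin mx)} (hX : Function.Injective X)
    (hm : Fintype.card ι ≤ A.m H) :
    ∀ᵐ θ ∂A.initLaw cw cb, (A.featureGram σ X θ).det ≠ 0 := by
  obtain ⟨θ, hθ⟩ := A.exists_featureGram_det_ne_zero hσ hH hX hm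
  have hnull : ∀ p : A.Index,
      NullSingletonClass (gaussianReal 0 (if p.2.2 = none then cb else cw)) := fun p =>
    nullSingletonClass_gaussianReal (by split_ifs <;> positivity)
  have hcont : Continuous fun θ => (A.featureGram σ X θ).det :=
    continuous_iff_continuousAt.2 fun θ =>
      (A.analyticAt_featureGram_det hσ.analytic X θ).continuousAt
  rw [initLaw]
  refine (ae_map_iff (p := fun θ : A.Param => (A.featureGram σ X θ).det ≠ 0)
    (WithLp.measurable_toLp 2 _).aemeasurable
    -- Positive variances make every Gaussian factor atomless, so the analytic zero set is null for
    -- the product law.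
    ((isClosed_singleton (x := (0 : ℝ))).preimage hcont).measurableSet.compl).2 ?_
  exact ae_ne_zero_of_analytic _
    (g := fun y : A.Index → ℝ => (A.featureGram σ X (WithLp.toLp 2 y)).det)
    (fun y _ => (A.analyticAt_featureGram_det hσ.analytic X _).fun_comp
      (((PiLp.continuousLinearEquiv 2 ℝ fun _ : A.Index => ℝ).symm :
        (A.Index → ℝ) →L[ℝ] A.Param).analyticAt y)) (x := fun p => θ p) hθ

end Architecture


/-! ### Second moments and the size of the features at initialization. -/

section Moments

lemma integral_sq_sum_gaussian {ι κ : Type*} [Fintype ι] [Fintype κ] (v : ι → ℝ≥0) {f : κ → ι}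
    (hf : Function.Injective f) (a : κ → ℝ) :
    Integrable (fun y : ι → ℝ => (∑ k, a k * y (f k)) ^ 2)
        (Measure.pi fun i => gaussianReal 0 (v i)) ∧
      ∫ y, (∑ k, a k * y (f k)) ^ 2 ∂(Measure.pi fun i => gaussianReal 0 (v i))
        = ∑ k, a k ^ 2 * v (f k) := by
  set μ := Measure.pi fun i => gaussianReal 0 (v i) with hμ
  have hmp : ∀ i, MeasurePreserving (fun y : ι → ℝ => y i) μ (gaussianReal 0 (v i)) :=
    fun i => measurePreserving_eval _ i
  have hid : ∀ i, MemLp (id : ℝ → ℝ) 2 (gaussianReal 0 (v i)) := fun i => memLp_id_gaussianReal 2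
  have hL : ∀ i, MemLp (fun y : ι → ℝ => y i) 2 μ := fun i =>
    (hid i).comp_measurePreserving (hmp i)
  have hX : ∀ k, MemLp (fun y : ι → ℝ => a k * y (f k)) 2 μ := fun k => (hL (f k)).const_mul _
  have hS : MemLp (fun y : ι → ℝ => ∑ k, a k * y (f k)) 2 μ := memLp_finsetSum _ fun k _ => hX k
  refine ⟨hS.integrable_sq, ?_⟩
  have hmean : ∀ i, ∫ y, y i ∂μ = 0 := fun i => by
    have := integral_map (μ := μ) (f := (id : ℝ → ℝ)) (hmp i).measurable.aemeasurable
      (by fun_prop)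
    rw [(hmp i).map_eq] at this
    exact this.symm.trans integral_id_gaussianReal
  have hzero : ∫ y, ∑ k, a k * y (f k) ∂μ = 0 := by
    rw [integral_finsetSum _ fun k _ => (hX k).integrable (by norm_num)]
    simp [integral_const_mul, hmean]
  have hvar : ∀ i, Var[fun y : ι → ℝ => y i; μ] = v i := fun i => by
    rw [← variance_fun_id_gaussianReal (μ := 0) (v := v i), ← (hmp i).map_eq,
      variance_map (by fun_prop) (hmp i).measurable.aemeasurable]
    rfl
  have hind : iIndepFun (fun i (y : ι → ℝ) => y i) μ :=
    iIndepFun_pi (X := fun _ => id) fun i => aemeasurable_id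
  have := IndepFun.variance_sum (μ := μ) (X := fun k (y : ι → ℝ) => a k * y (f k))
    (s := Finset.univ) (fun k _ => hX k) (fun k _ k' _ hkk' =>
      (hind.indepFun (hf.ne hkk')).comp (measurable_const_mul (a k)) (measurable_const_mul (a k')))
  rw [show (∑ k, fun y : ι → ℝ => a k * y (f k)) = fun y => ∑ k, a k * y (f k) from
    funext fun y => by simp, variance_of_integral_eq_zero hS.aestronglyMeasurable.aemeasurable
      hzero] at this
  rw [this]
  exact Finset.sum_congr rfl fun k _ => by rw [variance_const_mul, hvar]

end Moments

lemma IsActivation.sq_le {σ : ℝ → ℝ} (hσ : IsActivation σ) (t : ℝ) :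
    σ t ^ 2 ≤ 2 * σ 0 ^ 2 + 2 * t ^ 2 := by
  have h := hσ.lipschitz.dist_le_mul t 0
  simp only [Real.dist_eq, NNReal.coe_one, one_mul, sub_zero] at h
  have h2 : (σ t - σ 0) ^ 2 ≤ t ^ 2 := sq_le_sq.2 h
  nlinarith [sq_nonneg (σ t - 2 * σ 0)]

/-- A bound on the squared norms of the layers, when the initial weights have size at most `K`. -/
noncomputable def featureBound (s K : ℝ) : ℕ → ℝ
  | 0 => 0
  | l + 1 => 2 * s ^ 2 + 2 * (K * (featureBound s K l + 1))

namespace Architecture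

variable {mx my H : ℕ} (A : Architecture mx my H)

lemma affine_eq_sum_option (θ : A.Param) (l : Fin (H + 1)) (v : Fin (A.m l) → ℝ)
    (i : Fin (A.m (l + 1))) :
    A.affine θ l v i = ∑ o : Option (Fin (A.m l)), o.elim 1 v * θ ⟨l, (i, o)⟩ := by
  rw [Fintype.sum_option, affine]
  simp [mul_comm, add_comm]

/-- Cauchy–Schwarz in each row, with the bias read as the weight of a constant input `1`; this is
the source of the `+ 1`. -/
lemma sum_affine_sq_le (θ : A.Param) (l : Fin (H + 1)) (v : Fin (A.m l) → ℝ) :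
    ∑ i, A.affine θ l v i ^ 2 ≤ (∑ p : A.Block l, θ ⟨l, p⟩ ^ 2) * (∑ j, v j ^ 2 + 1) := by
  rw [Fintype.sum_prod_type, Finset.sum_mul]
  refine Finset.sum_le_sum fun i _ => ?_
  rw [affine_eq_sum_option]
  refine (Finset.sum_mul_sq_le_sq_mul_sq _ _ _).trans_eq ?_
  rw [mul_comm]
  congr 1
  rw [Fintype.sum_option]
  simp [add_comm]

lemma sum_layer_sq_le {σ : ℝ → ℝ} (hσ : IsActivation σ) (θ : A.Param)
    (x : EuclideanSpace ℝ (Fin mx)) (l : ℕ) (h : l + 1 ≤ H) :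
    ∑ i, A.layer σ θ x (l + 1) h i ^ 2 ≤ 2 * σ 0 ^ 2 + 2 * (1 / (A.m (l + 1) : ℝ) *
      ∑ i, A.affine θ ⟨l, by omega⟩ (A.layer σ θ x l (by omega)) i ^ 2) := by
  have hm : (0 : ℝ) < A.m (l + 1) := by
    have := A.m_pos (l + 1) (by omega) h
    positivity
  have h1 : ∀ i, A.layer σ θ x (l + 1) h i ^ 2 ≤ 1 / (A.m (l + 1) : ℝ) * (2 * σ 0 ^ 2 +
      2 * A.affine θ ⟨l, by omega⟩ (A.layer σ θ x l (by omega)) i ^ 2) := fun i => by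
    rw [layer]
    beta_reduce
    rw [mul_pow, div_pow, one_pow, Real.sq_sqrt hm.le]
    exact mul_le_mul_of_nonneg_left (hσ.sq_le _) (by positivity)
  refine (Finset.sum_le_sum fun i _ => h1 i).trans_eq ?_
  rw [← Finset.mul_sum, Finset.sum_add_distrib, ← Finset.mul_sum, ← Finset.mul_sum]
  simp only [Finset.sum_const, Finset.card_univ, Fintype.card_fin, nsmul_eq_mul]
  field_simp

/-- The mean square size of the first layer on the inputs, plus the mean square sizes of the
weights of the other hidden layers. -/
noncomputable def hiddenSize {n : ℕ} (X : Fin n → EuclideanSpace ℝ (Fin mx)) (θ : A.Param) : ℝ :=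
  1 / (n : ℝ) * ∑ i, (1 / (A.m 1 : ℝ) *
      ∑ r, A.affine θ ⟨0, by omega⟩ (fun j => X i (Fin.cast A.m_zero j)) r ^ 2) +
    ∑ l : Fin (H + 1) with l.1 ≠ 0 ∧ l.1 ≠ H, 1 / (A.m (l + 1) : ℝ) * ∑ p : A.Block l, θ ⟨l, p⟩ ^ 2

lemma continuous_hiddenSize {n : ℕ} (X : Fin n → EuclideanSpace ℝ (Fin mx)) :
    Continuous (A.hiddenSize X) := by
  unfold hiddenSize affine
  fun_prop

lemma hiddenSize_nonneg {n : ℕ} (X : Fin n → EuclideanSpace ℝ (Fin mx)) (θ : A.Param) :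
    0 ≤ A.hiddenSize X θ := by
  unfold hiddenSize
  positivity

lemma mean_sum_layer_sq_le {σ : ℝ → ℝ} (hσ : IsActivation σ) {n : ℕ} (hn : 1 ≤ n)
    (X : Fin n → EuclideanSpace ℝ (Fin mx)) {θ : A.Param} {K : ℝ} (hK : A.hiddenSize X θ ≤ K)
    (l : ℕ) (hl : l + 1 ≤ H) :
    1 / (n : ℝ) * ∑ i, ∑ j, A.layer σ θ (X i) (l + 1) hl j ^ 2 ≤ featureBound (σ 0) K (l + 1) := by
  have hn' : (0 : ℝ) < n := by positivity
  -- Passing through `σ` costs a factor independent of the width, thanks to the normalization `1 /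
  -- √m` of the layers.
  have hstep : ∀ (l : ℕ) (hl : l + 1 ≤ H) (B : ℝ), 1 / (n : ℝ) * ∑ i, (1 / (A.m (l + 1) : ℝ) *
      ∑ r, A.affine θ ⟨l, by omega⟩ (A.layer σ θ (X i) l (by omega)) r ^ 2) ≤ B →
      1 / (n : ℝ) * ∑ i, ∑ j, A.layer σ θ (X i) (l + 1) hl j ^ 2 ≤ 2 * σ 0 ^ 2 + 2 * B := by
    intro l hl B hB
    refine (mul_le_mul_of_nonneg_left (Finset.sum_le_sum fun i _ =>
      A.sum_layer_sq_le hσ θ (X i) l hl) (by positivity)).trans ?_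
    rw [Finset.sum_add_distrib, ← Finset.mul_sum, mul_add]
    refine add_le_add (le_of_eq ?_) (le_trans (le_of_eq ?_)
      (mul_le_mul_of_nonneg_left hB zero_le_two))
    · simp only [Finset.sum_const, Finset.card_univ, Fintype.card_fin, nsmul_eq_mul]
      field_simp
    · rw [mul_left_comm 2, Finset.mul_sum (a := (2 : ℝ))]
  induction l with
  | zero =>
    refine hstep 0 hl _ ?_
    -- The value `0` of `featureBound` at level `0` makes the first bound `2 σ(0)² + 2 K`: for the
    -- first layer, `K` controls the preactivations directly.
    simp only [featureBound, zero_add, mul_one]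
    refine le_trans ?_ hK
    unfold hiddenSize
    simp only [layer]
    exact le_add_of_nonneg_right (by positivity)
  | succ l ih =>
    refine hstep (l + 1) hl _ ?_
    have hih := ih (by omega) hstep
    set q : ℝ := 1 / (A.m (l + 2) : ℝ) * ∑ p : A.Block (l + 1), θ ⟨⟨l + 1, by omega⟩, p⟩ ^ 2 with hq
    have hq0 : 0 ≤ q := by positivity
    have hqK : q ≤ K := by
      refine le_trans ?_ hK
      unfold hiddenSize
      have hle := Finset.single_le_sum (s := Finset.univ.filter
          fun l : Fin (H + 1) => l.1 ≠ 0 ∧ l.1 ≠ H)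
        (f := fun l : Fin (H + 1) => 1 / (A.m (l + 1) : ℝ) * ∑ p : A.Block l, θ ⟨l, p⟩ ^ 2)
        (fun l _ => by positivity) (a := ⟨l + 1, by omega⟩) (by simp; omega)
      exact le_add_of_nonneg_of_le (by positivity) hle
    have hsum : ∀ i, 1 / (A.m (l + 1 + 1) : ℝ) *
        ∑ r, A.affine θ ⟨l + 1, by omega⟩ (A.layer σ θ (X i) (l + 1) (by omega)) r ^ 2 ≤
        q * (∑ j, A.layer σ θ (X i) (l + 1) (by omega) j ^ 2 + 1) := fun i => by
      rw [hq, mul_assoc]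
      exact mul_le_mul_of_nonneg_left (A.sum_affine_sq_le θ ⟨l + 1, by omega⟩ _) (by positivity)
    refine (mul_le_mul_of_nonneg_left (Finset.sum_le_sum fun i _ => hsum i)
      (by positivity)).trans ?_
    rw [← Finset.mul_sum, mul_left_comm, Finset.sum_add_distrib, mul_add]
    have h1 : 1 / (n : ℝ) * ∑ _i : Fin n, (1 : ℝ) = 1 := by
      simp only [Finset.sum_const, Finset.card_univ, Fintype.card_fin, nsmul_eq_mul]
      field_simp
    rw [h1]
    exact mul_le_mul hqK (add_le_add_left hih 1) (by positivity) (hq0.trans hqK)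

/-- Each piece has mean `cw + cb`: for the first layer because the inputs have unit norm, for the
later hidden layers because the layer feeding into them has width `1`. Using preactivations rather
than the weights of the first block keeps the bound free of `mx`, and averaging over the samples
keeps it free of `n`. -/
lemma integral_hiddenSize_le (cw cb : ℝ≥0) (h1 : ∀ l, 1 ≤ l → l < H → A.m l = 1) {n : ℕ}
    (hn : 1 ≤ n) (hH : 1 ≤ H)
    {X : Fin n → EuclideanSpace ℝ (Fin mx)} (hX : ∀ i, ‖X i‖ ^ 2 = 1) :
    let μ := Measure.pi fun p : A.Index => gaussianReal 0 (if p.2.2 = none then cb else cw)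
    Integrable (fun y => A.hiddenSize X (WithLp.toLp 2 y)) μ ∧
      ∫ y, A.hiddenSize X (WithLp.toLp 2 y) ∂μ ≤ (H + 1) * ((cw : ℝ) + cb) := by
  intro μ
  have hlin : ∀ (i : Fin n) (r : Fin (A.m 1)),
      Integrable (fun y : A.Index → ℝ => A.affine (WithLp.toLp 2 y) ⟨0, by omega⟩
      (fun j => X i (Fin.cast A.m_zero j)) r ^ 2) μ ∧
      ∫ y, A.affine (WithLp.toLp 2 y) ⟨0, by omega⟩
        (fun j => X i (Fin.cast A.m_zero j)) r ^ 2 ∂μ = cw + cb := by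
    intro i r
    have := integral_sq_sum_gaussian (fun p : A.Index => if p.2.2 = none then cb else cw)
      (f := fun o : Option (Fin (A.m 0)) => (⟨⟨0, by omega⟩, (r, o)⟩ : A.Index))
      (fun o o' h => congrArg (fun q => q.2) (eq_of_heq (Sigma.mk.inj h).2))
      (fun o => o.elim 1 fun j => X i (Fin.cast A.m_zero j))
    simp only [affine_eq_sum_option]
    refine ⟨this.1, this.2.trans ?_⟩
    have hnorm : ∑ j : Fin (A.m 0), X i (Fin.cast A.m_zero j) ^ 2 = 1 := by
      rw [← hX i, EuclideanSpace.real_norm_sq_eq]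
      exact Fintype.sum_equiv (finCongr A.m_zero) _ _ fun j => rfl
    rw [Fintype.sum_option]
    simp [← Finset.sum_mul, hnorm, add_comm]
  have hsq : ∀ p : A.Index, Integrable (fun y : A.Index → ℝ => y p ^ 2) μ ∧
      ∫ y, y p ^ 2 ∂μ = (if p.2.2 = none then cb else cw : ℝ≥0) := fun p => by
    simpa using integral_sq_sum_gaussian (fun p : A.Index => if p.2.2 = none then cb else cw)
      (f := fun _ : Unit => p) (fun _ _ _ => rfl) 1
  have hI₁ : Integrable (fun y : A.Index → ℝ => 1 / (n : ℝ) * ∑ i, (1 / (A.m 1 : ℝ) *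
      ∑ r, A.affine (WithLp.toLp 2 y) ⟨0, by omega⟩
        (fun j => X i (Fin.cast A.m_zero j)) r ^ 2)) μ :=
    (integrable_finsetSum _ fun i _ =>
      (integrable_finsetSum _ fun r _ => (hlin i r).1).const_mul _).const_mul _
  have hI₂ : ∀ l : Fin (H + 1), Integrable (fun y : A.Index → ℝ => 1 / (A.m (l + 1) : ℝ) *
      ∑ p : A.Block l, y ⟨l, p⟩ ^ 2) μ := fun l =>
    (integrable_finsetSum _ fun p _ => (hsq ⟨l, p⟩).1).const_mul _
  have hI₃ := integrable_finsetSum (Finset.univ.filter fun l : Fin (H + 1) => l.1 ≠ 0 ∧ l.1 ≠ H)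
    fun l _ => hI₂ l
  refine ⟨hI₁.add hI₃, ?_⟩
  have hE₁ : ∫ y : A.Index → ℝ, 1 / (n : ℝ) * ∑ i, (1 / (A.m 1 : ℝ) *
      ∑ r, A.affine (WithLp.toLp 2 y) ⟨0, by omega⟩
        (fun j => X i (Fin.cast A.m_zero j)) r ^ 2) ∂μ = cw + cb := by
    have hm := A.m_pos 1 le_rfl hH
    rw [integral_const_mul, integral_finsetSum _ fun i _ =>
      (integrable_finsetSum _ fun r _ => (hlin i r).1).const_mul _]
    simp only [integral_const_mul]
    rw [Finset.sum_congr rfl fun i _ => by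
      rw [integral_finsetSum _ fun r _ => (hlin i r).1, Finset.sum_congr rfl fun r _ => (hlin i r).2]]
    simp only [Finset.sum_const, Finset.card_univ, Fintype.card_fin, nsmul_eq_mul]
    field_simp
  have hE₂ : ∀ l : Fin (H + 1), l.1 ≠ 0 ∧ l.1 ≠ H → ∫ y : A.Index → ℝ, 1 / (A.m (l + 1) : ℝ) *
      ∑ p : A.Block l, y ⟨l, p⟩ ^ 2 ∂μ = cw + cb := by
    rintro l ⟨hl0, hlH⟩
    have hl := l.2
    have hm := A.m_pos (l + 1) (by omega) (by omega)
    rw [integral_const_mul, integral_finsetSum _ fun p _ => (hsq ⟨l, p⟩).1,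
      Finset.sum_congr rfl fun p _ => (hsq ⟨l, p⟩).2, Fintype.sum_prod_type]
    simp only [Fintype.sum_option]
    simp [h1 l (by omega) (by omega)]
    field_simp
    ring
  have hcard : ((Finset.univ.filter fun l : Fin (H + 1) => l.1 ≠ 0 ∧ l.1 ≠ H).card : ℝ) ≤ H := by
    have : (Finset.univ.filter fun l : Fin (H + 1) => l.1 ≠ 0 ∧ l.1 ≠ H) ⊆ Finset.univ.erase 0 :=
      fun l hl => by
        simp only [Finset.mem_filter] at hl
        exact Finset.mem_erase.2 ⟨fun h => hl.2.1 (by simp [h]), Finset.mem_univ _⟩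
    have := Finset.card_le_card this
    rw [Finset.card_erase_of_mem (Finset.mem_univ _), Finset.card_univ, Fintype.card_fin] at this
    exact_mod_cast this
  unfold hiddenSize
  rw [integral_add hI₁ hI₃, hE₁, integral_finsetSum _ fun l _ => hI₂ l,
    Finset.sum_congr rfl fun l hl => hE₂ l (Finset.mem_filter.1 hl).2, Finset.sum_const,
    nsmul_eq_mul]
  have := mul_le_mul_of_nonneg_right hcard (by positivity : (0 : ℝ) ≤ cw + cb)
  linarith

lemma initLaw_hiddenSize_le (cw cb : ℝ≥0) (hcw : 0 < cw) (h1 : ∀ l, 1 ≤ l → l < H → A.m l = 1)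
    {n : ℕ} (hn : 1 ≤ n) (hH : 1 ≤ H)
    {X : Fin n → EuclideanSpace ℝ (Fin mx)} (hX : ∀ i, ‖X i‖ ^ 2 = 1) {δ : ℝ} (hδ : 0 < δ) :
    A.initLaw cw cb {θ | (H + 1) * ((cw : ℝ) + cb) / δ ≤ A.hiddenSize X θ} ≤ ENNReal.ofReal δ := by
  obtain ⟨hint, hle⟩ := A.integral_hiddenSize_le cw cb h1 hn hH hX
  have hM : (0 : ℝ) < (H + 1) * ((cw : ℝ) + cb) := by positivity
  rw [initLaw]
  refine (Measure.map_apply (WithLp.measurable_toLp 2 _)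
    (isClosed_le continuous_const (A.continuous_hiddenSize X)).measurableSet).trans_le ?_
  -- Markov's inequality at the mean bound divided by `δ`.
  have := mul_meas_ge_le_integral_of_nonneg
    (Eventually.of_forall fun y => A.hiddenSize_nonneg X (WithLp.toLp 2 y)) hint
    ((H + 1) * ((cw : ℝ) + cb) / δ)
  rw [Measure.real_def] at this
  refine (ENNReal.le_ofReal_iff_toReal_le (measure_ne_top _ _) hδ.le).2 ?_
  have h2 := this.trans hle
  rw [div_mul_eq_mul_div, div_le_iff₀ hδ] at h2
  exact le_of_mul_le_mul_left h2 hM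

end Architecture


/-! ### Number of steps of gradient descent in terms of the distance to the minimizers. -/

section Descent

variable {E : Type*} [NormedAddCommGroup E] [InnerProductSpace ℝ E] [CompleteSpace E]

/-- The iterates of gradient descent with constant step size `s`. -/
noncomputable def descent (h : E → ℝ) (s : ℝ) (w₀ : E) : ℕ → E
  | 0 => w₀
  | t + 1 => descent h s w₀ t - s • gradient h (descent h s w₀ t)

variable {h : E → ℝ} {M : ℝ}

lemma norm_sub_descent_le (hd : Differentiable ℝ h) (hc : ConvexOn ℝ Set.univ h) (hM0 : 0 < M)
    (hM : ∀ x y, ‖gradient h x - gradient h y‖ ≤ M * ‖x - y‖) {z : E} (hz : z ∈ argmin h) (w₀ : E)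
    (t : ℕ) : ‖z - descent h M⁻¹ w₀ t‖ ≤ ‖z - w₀‖ := by
  have h1 := gradient_descent_potential hd hc hM0 hM (w := descent h M⁻¹ w₀) (fun t => rfl) z t
  have h2 := sub_nonneg.2 (hz (descent h M⁻¹ w₀ t))
  have h3 : 0 ≤ 2 / M * t * (h (descent h M⁻¹ w₀ t) - h z) := by positivity
  exact (sq_le_sq₀ (norm_nonneg _) (norm_nonneg _)).1 (by simp only [descent] at h1; linarith)

/-- The number of steps after which gradient descent is `ε`-optimal. -/
lemma exists_descent_le (hd : Differentiable ℝ h) (hc : ConvexOn ℝ Set.univ h) (hM0 : 0 < M)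
    (hM : ∀ x y, ‖gradient h x - gradient h y‖ ≤ M * ‖x - y‖) {z : E} (hz : z ∈ argmin h) (w₀ : E)
    {R : ℝ} (hR : sInf ((fun w => ‖w - w₀‖ ^ 2) '' argmin h) ≤ R) {ε : ℝ} (hε : 0 < ε) :
    ∃ t : ℕ, (t : ℝ) ≤ M * R / ε ∧ h (descent h M⁻¹ w₀ t) ≤ h z + ε := by
  have hval : ∀ z' ∈ argmin h, h z' = h z := fun z' hz' => le_antisymm (hz' z) (hz z')
  have hR0 : 0 ≤ R := by
    refine le_trans (Real.sInf_nonneg ?_) hR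
    rintro _ ⟨w, -, rfl⟩
    positivity
  -- Bounds valid for every minimizer pass to the infimum, so no nearest minimizer has to be chosen.
  have hlow : ∀ a : ℝ, (∀ z' ∈ argmin h, a ≤ ‖z' - w₀‖ ^ 2) → a ≤ R := fun a ha => by
    refine le_trans (le_csInf (Set.Nonempty.image _ ⟨z, hz⟩) ?_) hR
    rintro _ ⟨w, hw, rfl⟩
    exact ha w hw
  have hX : 0 ≤ M * R / ε := by positivity
  -- Rounding down leaves no additive constant in the step bound. If the result is `0`, then `M R <
  -- ε` and the starting point is already good enough by smoothness; otherwise `M R / ε < t + 1 ≤ 2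
  -- t`, and the factor `2` of the potential absorbs the rounding.
  refine ⟨⌊M * R / ε⌋₊, Nat.floor_le hX, ?_⟩
  have hlt := Nat.lt_floor_add_one (M * R / ε)
  set t := ⌊M * R / ε⌋₊ with ht
  rcases Nat.eq_zero_or_pos t with h0 | h0
  · rw [h0] at hlt ⊢
    simp only [Nat.cast_zero, zero_add] at hlt
    rw [div_lt_one hε] at hlt
    have h1 : 2 / M * (h w₀ - h z) ≤ R := hlow _ fun z' hz' => by
      have := sub_le_of_minimizer hd hM hz' w₀
      rw [hval z' hz'] at this
      rw [div_mul_eq_mul_div, div_le_iff₀ hM0]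
      linarith
    rw [div_mul_eq_mul_div, div_le_iff₀ hM0] at h1
    simp only [descent]
    linarith
  · have h1 : 2 / M * t * (h (descent h M⁻¹ w₀ t) - h z) ≤ R := hlow _ fun z' hz' => by
      have := gradient_descent_potential hd hc hM0 hM (w := descent h M⁻¹ w₀) (fun t => rfl) z' t
      rw [hval z' hz'] at this
      simp only [descent] at this
      have h2 := sq_nonneg ‖z' - descent h M⁻¹ w₀ t‖
      linarith
    have hΔ := sub_nonneg.2 (hz (descent h M⁻¹ w₀ t))
    have ht1 : (1 : ℝ) ≤ t := by exact_mod_cast h0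
    have hRpos : 0 < R := by
      have : (1 : ℝ) ≤ M * R / ε := ht1.trans (Nat.floor_le hX)
      rcases hR0.eq_or_lt with h | h
      · rw [← h] at this
        norm_num at this
      · exact h
    have h2 : M * R / ε ≤ 2 * t := by linarith
    have h3 := mul_le_mul_of_nonneg_right h2 hΔ
    have h4 : 2 * (t : ℝ) * (h (descent h M⁻¹ w₀ t) - h z) ≤ M * R := by
      have := mul_le_mul_of_nonneg_left h1 hM0.le
      refine le_trans (le_of_eq ?_) this
      field_simp
    have h5 := h3.trans h4
    rw [div_mul_eq_mul_div, div_le_iff₀ hε] at h5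
    have := le_of_mul_le_mul_left h5 (by positivity : 0 < M * R)
    linarith

end Descent

/-! ### Means of convex losses composed with linear maps. -/

section FiniteSum

variable {E : Type*} [NormedAddCommGroup E] [InnerProductSpace ℝ E]
  {n k : ℕ} {ζ : ℝ} {φ : Fin n → EuclideanSpace ℝ (Fin k) → ℝ}

lemma differentiable_mean_loss (hφ : ∀ i, IsLossCriterion ζ (φ i))
    (T : Fin n → E →L[ℝ] EuclideanSpace ℝ (Fin k)) :
    Differentiable ℝ fun w => 1 / (n : ℝ) * ∑ i, φ i (T i w) :=
  (Differentiable.fun_sum fun i _ =>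
    (hφ i).differentiable.comp (T i).differentiable).const_mul _

lemma convexOn_mean_loss (hφ : ∀ i, IsLossCriterion ζ (φ i))
    (T : Fin n → E →L[ℝ] EuclideanSpace ℝ (Fin k)) :
    ConvexOn ℝ Set.univ fun w => 1 / (n : ℝ) * ∑ i, φ i (T i w) := by
  refine ⟨convex_univ, fun x _ y _ a b ha hb hab => ?_⟩
  have h : ∀ i, φ i (T i (a • x + b • y)) ≤ a * φ i (T i x) + b * φ i (T i y) := fun i => by
    rw [map_add, map_smul, map_smul]
    exact (hφ i).convex.2 trivial trivial ha hb hab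
  simp only [smul_eq_mul]
  refine (mul_le_mul_of_nonneg_left (Finset.sum_le_sum fun i _ => h i)
    (by positivity)).trans_eq ?_
  rw [Finset.sum_add_distrib, ← Finset.mul_sum, ← Finset.mul_sum]
  ring

/-- Test the difference of gradients against itself. Each `T i` enters twice, once in the gradient
difference and once in the test vector, which produces its squared norm bound `a i`. The mean of
these bounds suffices, so only the average size of the features matters. -/
lemma lipschitz_gradient_mean_loss [CompleteSpace E] (hφ : ∀ i, IsLossCriterion ζ (φ i)) (hζ : 0 ≤ ζ)
    {T : Fin n → E →L[ℝ] EuclideanSpace ℝ (Fin k)} {a : Fin n → ℝ}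
    (ha0 : ∀ i, 0 ≤ a i) (ha : ∀ i w, ‖T i w‖ ^ 2 ≤ a i * ‖w‖ ^ 2) {M : ℝ}
    (hM : 1 / (n : ℝ) * ∑ i, ζ * a i ≤ M)
    (x y : E) :
    ‖gradient (fun w => 1 / (n : ℝ) * ∑ i, φ i (T i w)) x
      - gradient (fun w => 1 / (n : ℝ) * ∑ i, φ i (T i w)) y‖ ≤ M * ‖x - y‖ := by
  have hgrad : ∀ x u : E, inner ℝ (gradient (fun w => 1 / (n : ℝ) * ∑ i, φ i (T i w)) x) u
      = 1 / (n : ℝ) * ∑ i, inner ℝ (gradient (φ i) (T i x)) (T i u) := by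
    intro x u
    have hT : ∀ i, HasFDerivAt (fun w => φ i (T i w)) ((fderiv ℝ (φ i) (T i x)).comp (T i)) x :=
      fun i => ((hφ i).differentiable (T i x)).hasFDerivAt.comp x (T i).hasFDerivAt
    have := (HasFDerivAt.fun_sum (u := Finset.univ) fun i _ => hT i).const_mul (1 / (n : ℝ))
    rw [inner_gradient_left, this.fderiv]
    simp
  set u := gradient (fun w => 1 / (n : ℝ) * ∑ i, φ i (T i w)) x
      - gradient (fun w => 1 / (n : ℝ) * ∑ i, φ i (T i w)) y with hu
  have key : ∀ v : E, inner ℝ u v ≤ (1 / (n : ℝ) * ∑ i, ζ * a i) * (‖x - y‖ * ‖v‖) := by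
    intro v
    rw [hu, inner_sub_left, hgrad, hgrad, ← mul_sub, ← Finset.sum_sub_distrib, mul_assoc,
      Finset.sum_mul]
    refine mul_le_mul_of_nonneg_left (Finset.sum_le_sum fun i _ => ?_) (by positivity)
    rw [← inner_sub_left]
    refine (real_inner_le_norm _ _).trans ?_
    refine (mul_le_mul_of_nonneg_right ((hφ i).lipschitz _ _) (norm_nonneg _)).trans ?_
    rw [← map_sub, mul_assoc, mul_assoc]
    refine mul_le_mul_of_nonneg_left ?_ hζ
    refine abs_le_of_sq_le_sq' ?_ (mul_nonneg (ha0 i) (by positivity)) |>.2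
    rw [mul_pow, mul_pow, mul_pow]
    refine (mul_le_mul (ha i _) (ha i v) (by positivity)
      (mul_nonneg (ha0 i) (by positivity))).trans_eq ?_
    ring
  have h1 := key u
  rw [real_inner_self_eq_norm_sq] at h1
  rcases (norm_nonneg u).eq_or_lt with h0 | h0
  · rw [← h0]
    refine mul_nonneg (le_trans ?_ hM) (norm_nonneg _)
    exact mul_nonneg (by positivity) (Finset.sum_nonneg fun i _ => mul_nonneg hζ (ha0 i))
  · refine le_trans ?_ (mul_le_mul_of_nonneg_right hM (norm_nonneg _))
    refine le_of_mul_le_mul_right ?_ h0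
    linarith [sq ‖u‖]

end FiniteSum

/-- Continuity from above: `R` is finite everywhere, so its tail events decrease to the empty set.
This supplies `c_θ` without any moment bound on the interpolating weights. -/
lemma exists_measure_lt_le {α : Type*} [MeasurableSpace α] (μ : Measure α) [IsFiniteMeasure μ]
    {R : α → ℝ} (hR : Measurable R) {δ : ℝ≥0∞} (hδ : 0 < δ) : ∃ c : ℝ, μ {x | c < R x} ≤ δ := by
  have h := tendsto_measure_iInter_atTop (μ := μ) (s := fun k : ℕ => {x | (k : ℝ) < R x})
    (fun k => (measurableSet_lt measurable_const hR).nullMeasurableSet)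
    (fun j k hjk x hx => (Nat.cast_le.2 hjk).trans_lt (Set.mem_ofPred.1 hx)) ⟨0, measure_ne_top _ _⟩
  have he : ⋂ k : ℕ, {x | (k : ℝ) < R x} = ∅ := by
    ext x
    obtain ⟨k, hk⟩ := exists_nat_ge (R x)
    simp only [Set.mem_iInter, Set.mem_ofPred_eq, Set.mem_empty_iff_false, iff_false, not_forall,
      not_lt]
    exact ⟨k, hk⟩
  rw [he, measure_empty] at h
  obtain ⟨k, hk⟩ := ((tendsto_order.1 h).2 δ hδ).exists
  exact ⟨k, hk.le⟩

/-! ### Training the last block alone. -/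

namespace Architecture

variable {mx my H : ℕ} (A : Architecture mx my H)

/-- The last block of parameters. -/
abbrev lastBlock (_A : Architecture mx my H) : Fin (H + 1) := ⟨H, by omega⟩

@[simp]
lemma replaceBlock_apply_self (θ : A.Param) (l : Fin (H + 1)) (w : EuclideanSpace ℝ (A.Block l))
    (q : A.Block l) : A.replaceBlock θ l w ⟨l, q⟩ = w q := by
  simp [replaceBlock]

lemma replaceBlock_apply_of_ne (θ : A.Param) (l : Fin (H + 1)) (w : EuclideanSpace ℝ (A.Block l))
    {p : A.Index} (hp : p.1 ≠ l) : A.replaceBlock θ l w p = θ p := by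
  simp [replaceBlock, hp]

lemma replaceBlock_block (θ : A.Param) (l : Fin (H + 1)) :
    A.replaceBlock θ l (A.block θ l) = θ := by
  ext ⟨l', q⟩
  by_cases h : l' = l
  · subst h
    simp [block]
  · exact A.replaceBlock_apply_of_ne _ _ _ h

lemma differentiable_replaceBlock (θ : A.Param) (l : Fin (H + 1)) :
    Differentiable ℝ (A.replaceBlock θ l) := by
  rw [differentiable_euclidean]
  rintro ⟨l', q⟩
  by_cases h : l' = l
  · subst h
    simp only [replaceBlock_apply_self]
    fun_prop
  · simp only [A.replaceBlock_apply_of_ne θ l _ (p := ⟨l', q⟩) h]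
    fun_prop

lemma replaceBlock_add_single (θ : A.Param) (l : Fin (H + 1)) (w : EuclideanSpace ℝ (A.Block l))
    (q : A.Block l) (t : ℝ) : A.replaceBlock θ l (w + t • EuclideanSpace.single q 1)
      = A.replaceBlock θ l w + t • EuclideanSpace.single ⟨l, q⟩ 1 := by
  ext ⟨l', q'⟩
  by_cases h : l' = l
  · subst h
    by_cases hq : q' = q <;> simp [hq]
  · rw [A.replaceBlock_apply_of_ne _ _ _ h]
    simp [A.replaceBlock_apply_of_ne θ l _ (p := ⟨l', q'⟩) h, h]

lemma gradient_replaceBlock_apply {J : A.Param → ℝ} (hJ : Differentiable ℝ J) (θ : A.Param)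
    (l : Fin (H + 1)) (w : EuclideanSpace ℝ (A.Block l)) (q : A.Block l) :
    gradient (fun w => J (A.replaceBlock θ l w)) w q
      = gradient J (A.replaceBlock θ l w) ⟨l, q⟩ := by
  have h1 := hasDerivAt_comp_line (hJ.comp (A.differentiable_replaceBlock θ l)) w
    (EuclideanSpace.single q 1) 0
  have h2 := hasDerivAt_comp_line hJ (A.replaceBlock θ l w) (EuclideanSpace.single ⟨l, q⟩ 1) 0
  simp only [Function.comp_apply, replaceBlock_add_single] at h1
  have := h1.unique h2
  simpa only [zero_smul, add_zero, EuclideanSpace.inner_single_right, map_one, one_mul,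
    conj_trivial, Function.comp_def] using this

/-- Gradient descent on a single block. -/
lemma gd_eq_replaceBlock {J : A.Param → ℝ} (hJ : Differentiable ℝ J) (l : Fin (H + 1)) (s : ℝ)
    (θ : A.Param) (t : ℕ) : A.gd J (fun p => if p.1 = l then s else 0) θ t
      = A.replaceBlock θ l
        (descent (fun w => J (A.replaceBlock θ l w)) s (A.block θ l) t) := by
  induction t with
  | zero => exact (A.replaceBlock_block θ l).symm
  | succ t ih =>
    ext ⟨l', q⟩
    rw [gd, ih]
    by_cases h : l' = l
    · subst h
      rw [replaceBlock_apply_self]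
      simp [descent, A.gradient_replaceBlock_apply hJ]
    · rw [A.replaceBlock_apply_of_ne _ _ _ h]
      simp [h, A.replaceBlock_apply_of_ne θ l _ (p := ⟨l', q⟩) h]

lemma norm_replaceBlock_sub (θ : A.Param) (l : Fin (H + 1)) (w : EuclideanSpace ℝ (A.Block l)) :
    ‖A.replaceBlock θ l w - θ‖ = ‖w - A.block θ l‖ := by
  rw [← sq_eq_sq₀ (norm_nonneg _) (norm_nonneg _), EuclideanSpace.real_norm_sq_eq,
    EuclideanSpace.real_norm_sq_eq, Fintype.sum_sigma, Finset.sum_eq_single l]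
  · simp [block]
  · intro l' _ h
    refine Finset.sum_eq_zero fun q _ => ?_
    simp [A.replaceBlock_apply_of_ne θ l w (p := ⟨l', q⟩) h]
  · simp

lemma layer_replaceBlock_last (σ : ℝ → ℝ) (θ : A.Param) (w : EuclideanSpace ℝ (A.Block H))
    (x : EuclideanSpace ℝ (Fin mx)) : ∀ (l : ℕ) (h : l ≤ H),
      A.layer σ (A.replaceBlock θ A.lastBlock w) x l h = A.layer σ θ x l h
  | 0, _ => by simp only [layer]
  | l + 1, h => by
    have hne : (⟨l, by omega⟩ : Fin (H + 1)) ≠ A.lastBlock := by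
      simp only [ne_eq, Fin.mk.injEq]
      omega
    funext i
    simp only [layer]
    rw [layer_replaceBlock_last σ θ w x l (by omega)]
    simp only [affine]
    rw [A.replaceBlock_apply_of_ne θ A.lastBlock w hne]
    congr 3
    exact Finset.sum_congr rfl fun j _ => by
      rw [A.replaceBlock_apply_of_ne θ A.lastBlock w hne]

/-- The output of the network as a linear function of the parameters of the last block. -/
noncomputable def readout (v : Fin (A.m H) → ℝ) :
    EuclideanSpace ℝ (A.Block H) →L[ℝ] EuclideanSpace ℝ (Fin my) :=
  LinearMap.toContinuousLinearMap
    { toFun := fun w => WithLp.toLp 2 fun k =>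
        ∑ j, w (Fin.cast A.m_last.symm k, some j) * v j + w (Fin.cast A.m_last.symm k, none)
      map_add' := fun w w' => by
        ext k
        simp [add_mul, Finset.sum_add_distrib]
        ring
      map_smul' := fun a w => by
        ext k
        simp [mul_assoc, Finset.mul_sum, mul_add] }

lemma readout_apply (v : Fin (A.m H) → ℝ) (w : EuclideanSpace ℝ (A.Block H)) (k : Fin my) :
    A.readout v w k = ∑ j, w (Fin.cast A.m_last.symm k, some j) * v j
      + w (Fin.cast A.m_last.symm k, none) := rfl

lemma net_replaceBlock_last (σ : ℝ → ℝ) (θ : A.Param) (w : EuclideanSpace ℝ (A.Block H))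
    (x : EuclideanSpace ℝ (Fin mx)) :
    A.net σ (A.replaceBlock θ A.lastBlock w) x = A.readout (A.layer σ θ x H le_rfl) w := by
  ext k
  rw [readout_apply]
  simp only [net, affine, layer_replaceBlock_last]
  congr 1
  · exact Finset.sum_congr rfl fun j _ => by rw [A.replaceBlock_apply_self θ A.lastBlock w]
  · rw [A.replaceBlock_apply_self θ A.lastBlock w]

lemma norm_readout_sq_le (v : Fin (A.m H) → ℝ) (w : EuclideanSpace ℝ (A.Block H)) :
    ‖A.readout v w‖ ^ 2 ≤ (∑ j, v j ^ 2 + 1) * ‖w‖ ^ 2 := by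
  rw [EuclideanSpace.real_norm_sq_eq, EuclideanSpace.real_norm_sq_eq, Fintype.sum_prod_type,
    Finset.mul_sum]
  rw [← Fintype.sum_equiv (finCongr A.m_last.symm) (fun k => (∑ j, v j ^ 2 + 1) *
    ∑ o, w (Fin.cast A.m_last.symm k, o) ^ 2) _ fun k => rfl]
  refine Finset.sum_le_sum fun k _ => ?_
  have h := Finset.sum_mul_sq_le_sq_mul_sq Finset.univ (fun o : Option (Fin (A.m H)) => o.elim 1 v)
    (fun o => w (Fin.cast A.m_last.symm k, o))
  rw [readout_apply]
  simp only [Fintype.sum_option, Option.elim] at h ⊢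
  refine le_trans (le_of_eq ?_) (h.trans_eq ?_)
  · simp only [mul_comm, one_mul, add_comm]
  · simp only [one_pow, add_comm]

/-- Parameters of the last block with which the network takes given values at given inputs. -/
noncomputable def interpolator (σ : ℝ → ℝ) {ι : Type*} [Fintype ι] [DecidableEq ι]
    (X : ι → EuclideanSpace ℝ (Fin mx)) (F : ι → EuclideanSpace ℝ (Fin my)) (θ : A.Param) :
    EuclideanSpace ℝ (A.Block H) :=
  -- Zero bias, and weights that combine the feature vectors with coefficients `G⁻¹ F`. Writing
  -- `G⁻¹` as an inverse determinant times the adjugate makes measurability in `θ` evident, also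
  -- where `G` is singular.
  WithLp.toLp 2 fun p => p.2.elim 0 fun j => ∑ a, (A.featureGram σ X θ).det⁻¹ *
    (∑ b, (A.featureGram σ X θ).adjugate a b * F b (Fin.cast A.m_last p.1)) *
      A.layer σ θ (X a) H le_rfl j

lemma readout_interpolator {σ : ℝ → ℝ} {ι : Type*} [Fintype ι] [DecidableEq ι]
    {X : ι → EuclideanSpace ℝ (Fin mx)} (F : ι → EuclideanSpace ℝ (Fin my)) {θ : A.Param}
    (hθ : (A.featureGram σ X θ).det ≠ 0) (a : ι) :
    A.readout (A.layer σ θ (X a) H le_rfl) (A.interpolator σ X F θ) = F a := by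
  ext k
  have h : (A.featureGram σ X θ).mulVec ((A.featureGram σ X θ).adjugate.mulVec fun b => F b k) a
      = (A.featureGram σ X θ).det * F a k := by
    rw [Matrix.mulVec_mulVec, Matrix.mul_adjugate, Matrix.smul_mulVec, Matrix.one_mulVec]
    simp
  rw [readout_apply]
  simp only [interpolator, Option.elim, add_zero]
  have h2 : (A.featureGram σ X θ).det⁻¹ * ((A.featureGram σ X θ).det * F a k) = F a k := by
    field_simp
  rw [← h2, ← h]
  have hu : ∀ c, ∑ b, (A.featureGram σ X θ).adjugate c b * F b k
      = (A.featureGram σ X θ).adjugate.mulVec (fun b => F b k) c := fun c => rfl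
  simp only [Fin.cast_cast, Fin.cast_eq_self, hu]
  generalize (A.featureGram σ X θ).adjugate.mulVec (fun b => F b k) = u
  simp only [Matrix.mulVec, dotProduct, featureGram, Matrix.of_apply, Finset.sum_mul,
    Finset.mul_sum]
  rw [Finset.sum_comm]
  refine Finset.sum_congr rfl fun c _ => Finset.sum_congr rfl fun j _ => ?_
  ring

lemma measurable_interpolator {σ : ℝ → ℝ} (hσ : AnalyticOnNhd ℝ σ Set.univ) {ι : Type*} [Fintype ι]
    [DecidableEq ι] (X : ι → EuclideanSpace ℝ (Fin mx)) (F : ι → EuclideanSpace ℝ (Fin my)) :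
    Measurable (A.interpolator σ X F) := by
  have hl : ∀ x j, Continuous fun θ : A.Param => A.layer σ θ x H le_rfl j := fun x j =>
    continuous_iff_continuousAt.2 fun θ => (A.analyticAt_layer hσ x θ H le_rfl j).continuousAt
  have hG : Continuous (A.featureGram σ X) :=
    continuous_matrix fun a b => by
      simp only [featureGram, Matrix.of_apply]
      exact continuous_finsetSum _ fun j _ => (hl _ j).mul (hl _ j)
  refine (WithLp.measurable_toLp 2 _).comp (measurable_pi_iff.2 ?_)
  rintro ⟨k, _ | j⟩
  · exact measurable_const
  · refine Finset.measurable_fun_sum _ fun a _ => ?_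
    refine (hG.matrix_det.measurable.inv.mul (Continuous.measurable ?_)).mul (hl _ j).measurable
    exact continuous_finsetSum _ fun b _ =>
      ((hG.matrix_adjugate).matrix_elem a b).mul continuous_const

end Architecture


lemma featureBound_nonneg {s K : ℝ} (hK : 0 ≤ K) (l : ℕ) : 0 ≤ featureBound s K l := by
  induction l with
  | zero => exact le_rfl
  | succ l ih =>
    rw [featureBound]
    positivity

/-! ### Convergence from a good initialization, and the thin architecture. -/

namespace Architecture

variable {mx my H : ℕ} (A : Architecture mx my H)

lemma differentiable_objective {σ : ℝ → ℝ} (hσ : AnalyticOnNhd ℝ σ Set.univ) {n : ℕ}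
    {S : Dataset n mx my} {ℓ : EuclideanSpace ℝ (Fin my) → EuclideanSpace ℝ (Fin my) → ℝ} {ζ : ℝ}
    (hℓ : ∀ i, IsLossCriterion ζ fun q => ℓ q (S.y i)) :
    Differentiable ℝ (A.objective σ (lossFunctional ℓ S)) :=
  (Differentiable.fun_sum fun i _ =>
    (hℓ i).differentiable.comp (A.differentiable_net hσ (S.x i))).const_mul _

lemma objective_replaceBlock_last {σ : ℝ → ℝ} {n : ℕ} (S : Dataset n mx my)
    (ℓ : EuclideanSpace ℝ (Fin my) → EuclideanSpace ℝ (Fin my) → ℝ) (θ : A.Param) :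
    (fun w => A.objective σ (lossFunctional ℓ S) (A.replaceBlock θ A.lastBlock w))
      = fun w => 1 / (n : ℝ) * ∑ i,
        ℓ (A.readout (A.layer σ θ (S.x i) H le_rfl) w) (S.y i) := by
  funext w
  simp only [objective, lossFunctional, net_replaceBlock_last]

/-- The loss sees a function only through its values at the inputs, and no choice of the last block
can beat a minimizer over all functions. -/
lemma interpolator_mem_argmin {σ : ℝ → ℝ} {n : ℕ} {S : Dataset n mx my}
    {ℓ : EuclideanSpace ℝ (Fin my) → EuclideanSpace ℝ (Fin my) → ℝ}
    {ι : Type*} [Fintype ι] [DecidableEq ι] {X : ι → EuclideanSpace ℝ (Fin mx)}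
    (hX : ∀ i, ∃ a, X a = S.x i) {θ : A.Param} (hθ : (A.featureGram σ X θ).det ≠ 0)
    {f : EuclideanSpace ℝ (Fin mx) → EuclideanSpace ℝ (Fin my)}
    (hf : f ∈ argmin (lossFunctional ℓ S)) :
    A.objective σ (lossFunctional ℓ S) (A.replaceBlock θ A.lastBlock
        (A.interpolator σ X (fun a => f (X a)) θ)) = lossFunctional ℓ S f ∧
      A.interpolator σ X (fun a => f (X a)) θ ∈
        argmin fun w => A.objective σ (lossFunctional ℓ S) (A.replaceBlock θ A.lastBlock w) := by
  have h : A.objective σ (lossFunctional ℓ S) (A.replaceBlock θ A.lastBlock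
      (A.interpolator σ X (fun a => f (X a)) θ)) = lossFunctional ℓ S f := by
    simp only [objective, lossFunctional, net_replaceBlock_last]
    congr 1
    refine Finset.sum_congr rfl fun i _ => ?_
    obtain ⟨a, ha⟩ := hX i
    rw [← ha, A.readout_interpolator (fun a => f (X a)) hθ]
  exact ⟨h, fun w => h.le.trans (hf _)⟩

lemma sInf_le_initRadius (J : A.Param → ℝ) (θ : A.Param) (l : Fin (H + 1)) :
    sInf ((fun w => ‖w - A.block θ l‖ ^ 2) '' argmin fun w => J (A.replaceBlock θ l w))
      ≤ A.initRadius J θ :=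
  le_ciSup (f := fun l => sInf ((fun w => ‖w - A.block θ l‖ ^ 2) ''
    argmin fun w => J (A.replaceBlock θ l w))) (Set.finite_range _).bddAbove l

/-- Convergence of gradient descent on the last block, from a fixed initialization at which the
features are bounded on average and linearly independent. -/
lemma exists_gd_le {σ : ℝ → ℝ} (hσ : AnalyticOnNhd ℝ σ Set.univ) {n : ℕ} (hn : 1 ≤ n)
    {S : Dataset n mx my}
    {ℓ : EuclideanSpace ℝ (Fin my) → EuclideanSpace ℝ (Fin my) → ℝ} {ζ : ℝ} (hζ : 0 < ζ)
    (hℓ : ∀ i, IsLossCriterion ζ fun q => ℓ q (S.y i))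
    {ι : Type*} [Fintype ι] [DecidableEq ι] {X : ι → EuclideanSpace ℝ (Fin mx)}
    (hX : ∀ i, ∃ a, X a = S.x i) {θ : A.Param} (hθ : (A.featureGram σ X θ).det ≠ 0)
    {f : EuclideanSpace ℝ (Fin mx) → EuclideanSpace ℝ (Fin my)}
    (hf : f ∈ argmin (lossFunctional ℓ S)) {B : ℝ} (hB0 : 0 ≤ B)
    (hB : 1 / (n : ℝ) * ∑ i, ∑ j, A.layer σ θ (S.x i) H le_rfl j ^ 2 ≤ B) {ε : ℝ} (hε : 0 < ε) :
    ∃ t : ℕ, (t : ℝ) ≤ (B + 1) * (A.initRadius (A.objective σ (lossFunctional ℓ S)) θ * ζ / ε) ∧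
      A.objective σ (lossFunctional ℓ S) (A.gd (A.objective σ (lossFunctional ℓ S))
        (fun p => if p.1 = A.lastBlock then (ζ * (B + 1))⁻¹ else 0) θ t)
          ≤ lossFunctional ℓ S f + ε ∧
      ‖A.gd (A.objective σ (lossFunctional ℓ S))
        (fun p => if p.1 = A.lastBlock then (ζ * (B + 1))⁻¹ else 0) θ t‖ ≤
        ‖θ‖ + 2 * ‖A.interpolator σ X (fun a => f (X a)) θ - A.block θ A.lastBlock‖ := by
  have hn' : (0 : ℝ) < n := by positivity
  obtain ⟨hval, hmem⟩ := A.interpolator_mem_argmin hX hθ hf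
  have hrad := A.sInf_le_initRadius (A.objective σ (lossFunctional ℓ S)) θ A.lastBlock
  have hJ := A.differentiable_objective hσ hℓ
  simp only [A.gd_eq_replaceBlock hJ]
  set z := A.interpolator σ X (fun a => f (X a)) θ with hz
  have hM0 : 0 < ζ * (B + 1) := by positivity
  have hobj := A.objective_replaceBlock_last (σ := σ) S ℓ θ
  have hd : Differentiable ℝ fun w =>
      A.objective σ (lossFunctional ℓ S) (A.replaceBlock θ A.lastBlock w) := by
    rw [hobj]
    exact differentiable_mean_loss hℓ _
  have hc : ConvexOn ℝ Set.univ fun w =>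
      A.objective σ (lossFunctional ℓ S) (A.replaceBlock θ A.lastBlock w) := by
    rw [hobj]
    exact convexOn_mean_loss hℓ _
  have hM : ∀ x y, ‖gradient (fun w =>
      A.objective σ (lossFunctional ℓ S) (A.replaceBlock θ A.lastBlock w)) x - gradient (fun w =>
      A.objective σ (lossFunctional ℓ S) (A.replaceBlock θ A.lastBlock w)) y‖
      ≤ ζ * (B + 1) * ‖x - y‖ := by
    rw [hobj]
    refine lipschitz_gradient_mean_loss hℓ hζ.le
      (a := fun i => ∑ j, A.layer σ θ (S.x i) H le_rfl j ^ 2 + 1) (fun i => by positivity)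
      (fun i w => A.norm_readout_sq_le _ w) ?_
    rw [← Finset.mul_sum, mul_left_comm, Finset.sum_add_distrib, mul_add]
    have h1 : 1 / (n : ℝ) * ∑ _i : Fin n, (1 : ℝ) = 1 := by
      simp only [Finset.sum_const, Finset.card_univ, Fintype.card_fin, nsmul_eq_mul]
      field_simp
    rw [h1]
    gcongr
  obtain ⟨t, ht, hle⟩ := exists_descent_le hd hc hM0 hM hmem (A.block θ A.lastBlock) hrad hε
  refine ⟨t, ht.trans_eq (by ring), hle.trans_eq (by rw [hval]), ?_⟩
  set w := descent (fun w => A.objective σ (lossFunctional ℓ S)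
    (A.replaceBlock θ A.lastBlock w)) (ζ * (B + 1))⁻¹ (A.block θ A.lastBlock) t with hw
  -- The distance to the interpolating minimizer never exceeds its initial value. The resulting norm
  -- bound does not involve `t`, hence not `ε`.
  have h1 := norm_sub_descent_le hd hc hM0 hM hmem (A.block θ A.lastBlock) t
  rw [← hw] at h1
  have h2 : ‖A.replaceBlock θ A.lastBlock w‖ ≤ ‖θ‖ + ‖w - A.block θ A.lastBlock‖ := by
    rw [← A.norm_replaceBlock_sub]
    exact norm_le_norm_add_norm_sub' _ _
  have h3 : ‖w - A.block θ A.lastBlock‖ ≤ ‖z - w‖ + ‖z - A.block θ A.lastBlock‖ := by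
    rw [norm_sub_rev z w]
    exact norm_sub_le_norm_sub_add_norm_sub _ _ _
  linarith

/-- The architecture with hidden widths `1, …, 1, n`. -/
def thin {n : ℕ} (hn : 1 ≤ n) (mx my H : ℕ) : Architecture mx my H where
  m l := if l = 0 then mx else if l = H + 1 then my else if l = H then n else 1
  m_zero := by simp
  m_last := by simp
  m_pos l h1 h2 := by
    have h3 : l ≠ 0 := by omega
    have h4 : l ≠ H + 1 := by omega
    simp only [h3, h4, if_false]
    split_ifs <;> omega

lemma thin_numParams {n : ℕ} (hn : 1 ≤ n) (mx my h : ℕ) :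
    (thin hn mx my (h + 2)).numParams
      = mx + 1 + 2 * h + 2 * n + (n * my + my) := by
  have hm : ∀ l, (thin hn mx my (h + 2)).m l
      = if l = 0 then mx else if l = h + 3 then my else if l = h + 2 then n else 1 := fun l => rfl
  have hmid : ∑ l ∈ Finset.range h, ((thin hn mx my (h + 2)).m (l + 1)
      * (thin hn mx my (h + 2)).m (l + 1 + 1)
      + (thin hn mx my (h + 2)).m (l + 1 + 1)) = ∑ l ∈ Finset.range h, 2 := by
    refine Finset.sum_congr rfl fun l hl => ?_
    have := Finset.mem_range.1 hl
    simp only [hm]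
    rw [if_neg (by omega), if_neg (by omega), if_neg (by omega), if_neg (by omega),
      if_neg (by omega), if_neg (by omega)]
  rw [numParams, Finset.sum_range_succ, Finset.sum_range_succ, Finset.sum_range_succ', hmid]
  simp [hm]
  ring

end Architecture

theorem probablyTrainable_of_architecture {σ : ℝ → ℝ} (hσ : IsActivation σ) {cw cb : ℝ≥0}
    (hcw : 0 < cw) (hcb : 0 < cb) {H : ℕ} (hH : 2 ≤ H) {δ : ℝ} (hδ : 0 < δ) {n mx my d : ℕ}
    (hn : 1 ≤ n) (A : Architecture mx my H) (h1 : ∀ l, 1 ≤ l → l < H → A.m l = 1)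
    (hm : A.m H = n) (hd : A.numParams ≤ d) :
    ProbablyTrainable σ cw cb mx my
      (featureBound (σ 0) ((H + 1) * ((cw : ℝ) + cb) / (δ / 2)) H + 1) n H δ d := by
  classical
  set K : ℝ := (H + 1) * ((cw : ℝ) + cb) / (δ / 2) with hK
  have hK0 : 0 ≤ K := by positivity
  set B := featureBound (σ 0) K H with hB
  have hB0 : 0 ≤ B := featureBound_nonneg hK0 H
  intro ζ hζ
  -- The step size depends on `ζ` and on the a priori bound `B` alone, as it must be fixed before
  -- the dataset and the loss.
  refine ⟨A, hd, fun p => if p.1 = A.lastBlock then (ζ * (B + 1))⁻¹ else 0, ?_⟩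
  rintro S L ⟨ℓ, hℓ, rfl, f, hf⟩
  -- Inputs may repeat, which would make their Gram matrix singular; independence is therefore
  -- required only over the distinct inputs.
  let T : Finset (EuclideanSpace ℝ (Fin mx)) := Finset.univ.image S.x
  let X : T → EuclideanSpace ℝ (Fin mx) := Subtype.val
  have hX : ∀ i, ∃ a, X a = S.x i := fun i =>
    ⟨⟨S.x i, Finset.mem_image_of_mem _ (Finset.mem_univ i)⟩, rfl⟩
  have hcard : Fintype.card T ≤ A.m H := by
    rw [hm, Fintype.card_coe]
    exact Finset.card_image_le.trans_eq (by simp)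
  have hblock : Measurable fun θ : A.Param => A.block θ A.lastBlock :=
    (WithLp.measurable_toLp 2 _).comp (measurable_pi_iff.2 fun p => by fun_prop)
  have hR : Measurable fun θ : A.Param => (‖θ‖ + 2 *
      ‖A.interpolator σ X (fun a => f (X a)) θ - A.block θ A.lastBlock‖) ^ 2 :=
    (measurable_norm.add (((A.measurable_interpolator hσ.analytic X _).sub
      hblock).norm.const_mul 2)).pow_const 2
  obtain ⟨c, hc⟩ := exists_measure_lt_le (A.initLaw cw cb) hR
    (ENNReal.ofReal_pos.2 (half_pos hδ))
  refine ⟨c, fun ε hε => ?_⟩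
  have hbig := A.initLaw_hiddenSize_le cw cb hcw h1 hn (by omega) S.norm_x (half_pos hδ)
  have hdet := ae_iff.1 (A.ae_featureGram_det_ne_zero hσ hH hcw hcb
    (X := X) Subtype.val_injective hcard)
  -- The three bad events: large hidden weights, singular Gram matrix, and large norm bound for the
  -- iterates.
  have hsum : ENNReal.ofReal δ = ENNReal.ofReal (δ / 2) + 0 + ENNReal.ofReal (δ / 2) := by
    rw [add_zero, ← ENNReal.ofReal_add (by positivity) (by positivity), add_halves]
  rw [hsum]
  refine le_trans (measure_mono ?_) ((measure_union_le _ _).trans (add_le_add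
    ((measure_union_le _ _).trans (add_le_add hbig hdet.le)) hc))
  intro θ hθ
  by_contra hgood
  simp only [Set.mem_union, Set.mem_ofPred_eq, not_or, not_not, not_le, not_lt] at hgood
  obtain ⟨⟨hg1, hg2⟩, hg3⟩ := hgood
  have hfeat : 1 / (n : ℝ) * ∑ i, ∑ j, A.layer σ θ (S.x i) H le_rfl j ^ 2 ≤ B := by
    obtain ⟨h, rfl⟩ : ∃ h, H = h + 1 := ⟨H - 1, by omega⟩
    exact A.mean_sum_layer_sq_le hσ hn S.x hg1.le h le_rfl
  obtain ⟨t, ht, hle, hnorm⟩ := A.exists_gd_le hσ.analytic hn hζ hℓ hX hg2 hf hB0 hfeat hε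
  refine hθ ⟨t, ht, fun fstar hfstar => ?_, ?_⟩
  -- All global minimizers of the loss share one value.
  · rwa [le_antisymm (hfstar f) (hf fstar)]
  · exact (pow_le_pow_left₀ (norm_nonneg _) hnorm 2).trans hg3

/-- Since `H ≥ 2` and `δ ≤ 1`, the logarithm is at least `log 2 > 1/2`; each term of the parameter
count is then absorbed by a term of the budget. -/
lemma thin_size_le {n mx my h : ℕ} {δ : ℝ} (hn : 1 ≤ n) (hδ : 0 < δ) (hδ1 : δ ≤ 1) :
    ((mx + 1 + 2 * h + 2 * n + (n * my + my) : ℕ) : ℝ) ≤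
      10 * (((n : ℝ) + mx * ((h + 2 : ℕ) : ℝ) ^ 2 + ((h + 2 : ℕ) : ℝ) ^ 5 *
        Real.log ((h + 2 : ℕ) * (n : ℝ) ^ 2 / δ)) *
          Real.log ((h + 2 : ℕ) * (n : ℝ) ^ 2 / δ) + n * my) := by
  have hn' : (1 : ℝ) ≤ n := by exact_mod_cast hn
  have hmy : (0 : ℝ) ≤ my := by positivity
  have hmx : (0 : ℝ) ≤ mx := by positivity
  set η : ℝ := ((h + 2 : ℕ) : ℝ) with hη
  have hη2 : η = h + 2 := by simp [hη]
  have hh : (2 : ℝ) ≤ η := by rw [hη2]; linarith [(Nat.cast_nonneg h : (0 : ℝ) ≤ h)]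
  set Λ := Real.log (η * (n : ℝ) ^ 2 / δ) with hΛ
  have hΛ2 : 1 / 2 ≤ Λ := by
    have h2 : (2 : ℝ) ≤ η * (n : ℝ) ^ 2 / δ := by
      rw [le_div_iff₀ hδ]
      nlinarith [mul_le_mul hh (one_le_pow₀ hn' (n := 2)) zero_le_one (by linarith)]
    have := Real.log_le_log two_pos h2
    linarith [Real.log_two_gt_d9]
  have e2 : 16 * η ≤ η ^ 5 := by
    have : (2 : ℝ) ^ 4 ≤ η ^ 4 := pow_le_pow_left₀ two_pos.le hh 4
    calc 16 * η ≤ η ^ 4 * η := mul_le_mul_of_nonneg_right (by linarith) (by linarith)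
      _ = η ^ 5 := by ring
  have e3 : 4 * (mx : ℝ) ≤ mx * η ^ 2 := by
    rw [mul_comm]
    exact mul_le_mul_of_nonneg_left (by nlinarith) hmx
  have e4 : 8 * η ≤ η ^ 5 * Λ := by nlinarith
  have e5 : ((n : ℝ) + 4 * mx + 8 * η) * (1 / 2) ≤ (n + mx * η ^ 2 + η ^ 5 * Λ) * Λ :=
    mul_le_mul (by linarith) hΛ2 (by norm_num) (by positivity)
  have e6 : (my : ℝ) ≤ n * my := le_mul_of_one_le_left hmy hn'
  push_cast
  nlinarith

end DeepNet

theorem theorem1 :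
    ∃ c : ℝ, 0 < c ∧
      ∀ (σ : ℝ → ℝ) (_ : DeepNet.IsActivation σ) (cw cb : ℝ≥0) (_ : 0 < cw) (_ : 0 < cb)
        (H : ℕ) (_ : 2 ≤ H) (δ : ℝ) (_ : 0 < δ) (_ : δ ≤ 1),
        ∃ C : ℝ, 0 < C ∧
          ∀ (n mx my d : ℕ) (_ : 1 ≤ n) (_ : 1 ≤ mx) (_ : 1 ≤ my),
            c * (((n : ℝ) + mx * (H : ℝ) ^ 2 + (H : ℝ) ^ 5 * Real.log (H * (n : ℝ) ^ 2 / δ)) *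
                Real.log (H * (n : ℝ) ^ 2 / δ) + n * my) ≤ d →
            DeepNet.ProbablyTrainable σ cw cb mx my C n H δ d := by
  refine ⟨10, by norm_num, fun σ hσ cw cb hcw hcb H hH δ hδ hδ1 => ?_⟩
  refine ⟨DeepNet.featureBound (σ 0) ((H + 1) * ((cw : ℝ) + cb) / (δ / 2)) H + 1,
    add_pos_of_nonneg_of_pos (DeepNet.featureBound_nonneg (by positivity) H) one_pos, ?_⟩
  intro n mx my d hn _ _ hd
  refine DeepNet.probablyTrainable_of_architecture hσ hcw hcb hH hδ hn
    (DeepNet.Architecture.thin hn mx my H) (fun l h1 h2 => ?_) ?_ ?_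
  · simp only [DeepNet.Architecture.thin]
    rw [if_neg (by omega), if_neg (by omega), if_neg (by omega)]
  · simp only [DeepNet.Architecture.thin]
    rw [if_neg (by omega), if_neg (by omega), if_pos trivial]
  · obtain ⟨h, rfl⟩ : ∃ h, H = h + 2 := ⟨H - 2, by omega⟩
    rw [DeepNet.Architecture.thin_numParams]
    exact_mod_cast (DeepNet.thin_size_le hn hδ hδ1).trans hd
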